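/- **Coloured bin packing.** An instance $I$ is a finite list of items $e$, each with a rational size $s(e)\in(0,1]$ and a colour from $\{1,\dots,m\}$; $I_c$ denotes the sub-instance of its items of colour $c$. A packing $P$ of $I$ assigns the items to bins so that the total size in each bin is at most $1$. $P(I)$ is the number of bins used, $P_c(I)$ is the number of bins that contain an item of colour $c$, and $\mathrm{OPT}(I)$ is the minimum of $P(I)$ over all packings $P$ of $I$. For $\beta>1$, $\mathrm{OPT}_\beta(I)$ is the minimum of $P(I)$ over all packings $P$ of $I$ with colour stretch at most $\beta$, that is, with $P_c(I)\le\beta\,\mathrm{OPT}(I_c)$ for every colour $c$. **Theorem.** Let $m$ be a fixed number of colours and let $\beta>1$ be real. There are constants $K$ and $C$, depending only on $m$ and $\beta$, such that for every $\varepsilon>0$ there is an algorithm which, on every instance $I$ with colours from $\{1,\dots,m\}$, runs in time polynomial in the length of the binary encoding of $I$ (the polynomial may depend on $m$, $\beta$ and $\varepsilon$) and outputs a packing $P$ of $I$ with $$P(I)\le(1+K\varepsilon)\,\mathrm{OPT}_\beta(I)+C\qquad\text{and}\qquad P_c(I)\le\beta(1+K\varepsilon)\,\mathrm{OPT}(I_c)+C\quad\text{for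 every colour }c.$$ -/

import Mathlib

namespace ColouredBinPacking

/-! ## Coloured bin packing -/

/-- An item with a colour among `m` colours and a rational size in `(0, 1]`. -/
structure Item (m : ℕ) where
  colour : Fin m
  size : ℚ
  size_pos : 0 < size
  size_le_one : size ≤ 1

/-- An instance is a finite list of coloured items; items are identified by their positions. -/
abbrev Instance (m : ℕ) : Type := List (Item m)

/-- The sub-instance `I_c` of all items of colour `c`. -/
def Instance.ofColour {m : ℕ} (I : Instance m) (c : Fin m) : Instance m :=
  List.filter (fun e => decide (e.colour = c)) I

/-- A packing of `I` into unit-capacity bins, the bins being numbered by `ℕ`. -/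
structure Packing {m : ℕ} (I : Instance m) where
  bin : Fin I.length → ℕ
  fits : ∀ b : ℕ, ∑ i with bin i = b, (I.get i).size ≤ 1

/-- The number `P(I)` of bins that are used. -/
def Packing.bins {m : ℕ} {I : Instance m} (P : Packing I) : ℕ :=
  (Finset.univ.image P.bin).card

/-- The number `P_c(I)` of bins that contain an item of colour `c`. -/
def Packing.span {m : ℕ} {I : Instance m} (P : Packing I) (c : Fin m) : ℕ :=
  ((Finset.univ.filter fun i => (I.get i).colour = c).image P.bin).card

/-- `OPT(I)`, the least number of bins of a packing of `I`. -/
noncomputable def opt {m : ℕ} (I : Instance m) : ℕ :=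
  sInf {k | ∃ P : Packing I, P.bins = k}

/-- The packing has colour stretch at most `β`: each colour `c` spans at most `β OPT(I_c)` bins. -/
def Packing.ColourStretchLE {m : ℕ} {I : Instance m} (P : Packing I) (β : ℝ) : Prop :=
  ∀ c : Fin m, (P.span c : ℝ) ≤ β * (opt (I.ofColour c) : ℝ)

/-- `OPT_β(I)`, the least number of bins of a packing of `I` with colour stretch at most `β`.
For `β ≥ 1` such packings exist: pack every colour optimally into bins of its own. -/
noncomputable def optStretch {m : ℕ} (β : ℝ) (I : Instance m) : ℕ :=
  sInf {k | ∃ P : Packing I, P.ColourStretchLE β ∧ P.bins = k}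

/-! ## Algorithms and their running time

A first-order programming language over pairs and natural numbers in binary. Pairing, projecting,
composing, branching and testing a loop condition cost one step each (as pointer operations do),
and an arithmetic operation or comparison costs one step plus the number of bits of its operands.
-/

/-- Data: natural numbers and ordered pairs. -/
inductive Val : Type
  | num : ℕ → Val
  | pair : Val → Val → Val

namespace Val

/-- The number held by a value (`0` for a pair). -/
def toNat : Val → ℕ
  | num n => n
  | pair _ _ => 0

/-- First component (`0` for a number). -/
def fst : Val → Val
  | num _ => num 0
  | pair a _ => a

/-- Second component (`0` for a number). -/
def snd : Val → Val
  | num _ => num 0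
  | pair _ b => b

/-- `1` for a pair and `0` for a number. -/
def isPair : Val → Val
  | num _ => num 0
  | pair _ _ => num 1

/-- The length of a value in binary: one unit for each node and one for each bit. -/
def length : Val → ℕ
  | num n => 1 + n.size
  | pair a b => 1 + a.length + b.length

/-- A list as nested pairs, ending in the number `0`. -/
def ofList : List Val → Val
  | [] => num 0
  | a :: l => pair a (ofList l)

end Val

/-- The four binary operations on numbers: addition, truncated subtraction, multiplication and
comparison. -/
inductive Op : Type
  | add
  | sub
  | mul
  | le

/-- The meaning of the binary operations (`le` gives `1` if `a ≤ b` and `0` otherwise). -/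
def Op.apply : Op → ℕ → ℕ → ℕ
  | add, a, b => a + b
  | sub, a, b => a - b
  | mul, a, b => a * b
  | le, a, b => if a ≤ b then 1 else 0

/-- Programs. Each program maps an input value to an output value, if it halts. -/
inductive Code : Type
  | id : Code
  | const : ℕ → Code
  | fst : Code
  | snd : Code
  | isPair : Code
  | op : Op → Code
  | pair : Code → Code → Code
  | comp : Code → Code → Code
  | cond : Code → Code → Code → Code
  | loop : Code → Code → Code

/-- `Eval A v w t`: program `A` halts on input `v` with output `w` after exactly `t` steps.
Here `comp g f` runs `f` and then `g`, `cond c f g` runs `f` if `c` gives a nonzero number and `g`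
otherwise, and `loop c f` repeats `f` as long as `c` gives a nonzero number. -/
inductive Eval : Code → Val → Val → ℕ → Prop
  | id (v : Val) : Eval Code.id v v 1
  | const (n : ℕ) (v : Val) : Eval (Code.const n) v (Val.num n) (1 + n.size)
  | fst (v : Val) : Eval Code.fst v v.fst 1
  | snd (v : Val) : Eval Code.snd v v.snd 1
  | isPair (v : Val) : Eval Code.isPair v v.isPair 1
  | op (o : Op) (v : Val) :
      Eval (Code.op o) v (Val.num (o.apply v.fst.toNat v.snd.toNat))
        (1 + v.fst.toNat.size + v.snd.toNat.size)
  | pair {f g : Code} {v a b : Val} {s t : ℕ} :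
      Eval f v a s → Eval g v b t → Eval (Code.pair f g) v (Val.pair a b) (s + t + 1)
  | comp {g f : Code} {v w u : Val} {s t : ℕ} :
      Eval f v w s → Eval g w u t → Eval (Code.comp g f) v u (s + t + 1)
  | condTrue {c f g : Code} {v w a : Val} {s t : ℕ} :
      Eval c v w s → w.toNat ≠ 0 → Eval f v a t → Eval (Code.cond c f g) v a (s + t + 1)
  | condFalse {c f g : Code} {v w a : Val} {s t : ℕ} :
      Eval c v w s → w.toNat = 0 → Eval g v a t → Eval (Code.cond c f g) v a (s + t + 1)
  | loopStop {c f : Code} {v w : Val} {s : ℕ} :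
      Eval c v w s → w.toNat = 0 → Eval (Code.loop c f) v v (s + 1)
  | loopStep {c f : Code} {v w u x : Val} {r s t : ℕ} :
      Eval c v w r → w.toNat ≠ 0 → Eval f v u s → Eval (Code.loop c f) u x t →
        Eval (Code.loop c f) v x (r + s + t + 1)

/-- Programs are deterministic, in their outputs and in their step counts. -/
theorem Eval.deterministic {A : Code} {v w : Val} {t : ℕ} (h : Eval A v w t) :
    ∀ {w' : Val} {t' : ℕ}, Eval A v w' t' → w = w' ∧ t = t' := by
  induction h with
  | id v => intro w' t' h'; cases h'; exact ⟨rfl, rfl⟩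
  | const n v => intro w' t' h'; cases h'; exact ⟨rfl, rfl⟩
  | fst v => intro w' t' h'; cases h'; exact ⟨rfl, rfl⟩
  | snd v => intro w' t' h'; cases h'; exact ⟨rfl, rfl⟩
  | isPair v => intro w' t' h'; cases h'; exact ⟨rfl, rfl⟩
  | op o v => intro w' t' h'; cases h'; exact ⟨rfl, rfl⟩
  | pair _ _ ih1 ih2 =>
    intro w' t' h'
    cases h' with
    | pair h1 h2 =>
      obtain ⟨rfl, rfl⟩ := ih1 h1
      obtain ⟨rfl, rfl⟩ := ih2 h2
      exact ⟨rfl, rfl⟩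
  | comp _ _ ih1 ih2 =>
    intro w' t' h'
    cases h' with
    | comp h1 h2 =>
      obtain ⟨rfl, rfl⟩ := ih1 h1
      obtain ⟨rfl, rfl⟩ := ih2 h2
      exact ⟨rfl, rfl⟩
  | condTrue _ hw _ ih1 ih2 =>
    intro w' t' h'
    cases h' with
    | condTrue h1 _ h2 =>
      obtain ⟨rfl, rfl⟩ := ih1 h1
      obtain ⟨rfl, rfl⟩ := ih2 h2
      exact ⟨rfl, rfl⟩
    | condFalse h1 hz _ =>
      obtain ⟨rfl, rfl⟩ := ih1 h1
      exact absurd hz hw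
  | condFalse _ hw _ ih1 ih2 =>
    intro w' t' h'
    cases h' with
    | condTrue h1 hz _ =>
      obtain ⟨rfl, rfl⟩ := ih1 h1
      exact absurd hw hz
    | condFalse h1 _ h2 =>
      obtain ⟨rfl, rfl⟩ := ih1 h1
      obtain ⟨rfl, rfl⟩ := ih2 h2
      exact ⟨rfl, rfl⟩
  | loopStop _ hw ih1 =>
    intro w' t' h'
    cases h' with
    | loopStop h1 _ =>
      obtain ⟨rfl, rfl⟩ := ih1 h1
      exact ⟨rfl, rfl⟩
    | loopStep h1 hz _ _ =>
      obtain ⟨rfl, rfl⟩ := ih1 h1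
      exact absurd hw hz
  | loopStep _ hw _ _ ih1 ih2 ih3 =>
    intro w' t' h'
    cases h' with
    | loopStop h1 hz =>
      obtain ⟨rfl, rfl⟩ := ih1 h1
      exact absurd hz hw
    | loopStep h1 _ h2 h3 =>
      obtain ⟨rfl, rfl⟩ := ih1 h1
      obtain ⟨rfl, rfl⟩ := ih2 h2
      obtain ⟨rfl, rfl⟩ := ih3 h3
      exact ⟨rfl, rfl⟩

/-! ## Encoding of inputs and outputs -/

/-- An item is given by its colour and the numerator and denominator of its size. -/
def Item.encode {m : ℕ} (e : Item m) : Val :=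
  Val.pair (Val.num e.colour) (Val.pair (Val.num e.size.num.toNat) (Val.num e.size.den))

/-- An instance is given as the list of its items. -/
def Instance.encode {m : ℕ} (I : Instance m) : Val :=
  Val.ofList (List.map Item.encode I)

/-- A packing is given as the list of the bin numbers of the items, in the order of the items. -/
def Packing.encode {m : ℕ} {I : Instance m} (P : Packing I) : Val :=
  Val.ofList (List.ofFn fun i => Val.num (P.bin i))

/-- `A` is a polynomial-time packing algorithm for instances with `m` colours whose packings all
have the property `Q`: on every instance `I` it halts, within a number of steps that is polynomial
in the length of the binary encoding of `I`, and outputs a packing of `I` for which `Q` holds. -/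
def Code.PacksInPolyTime (A : Code) (m : ℕ) (Q : ∀ I : Instance m, Packing I → Prop) : Prop :=
  ∃ q : Polynomial ℕ, ∀ I : Instance m, ∃ (P : Packing I) (t : ℕ),
    Eval A I.encode P.encode t ∧ t ≤ q.eval I.encode.length ∧ Q I P

end ColouredBinPacking

/-!
The algorithm tries polynomially many candidate packings and returns the best of the balanced ones.

*Candidates.* Fix a large integer `L`, and call an item small if its size is at most `1 / L`. A
packing `P` of the instance is described, up to a small error, by boundedly many data. In each
colour, linear grouping of the large items gives at most `L ^ 2 + 1` reference sizes
(`exists_grouping`); together with the reference size `1 / L` of the small items this makes a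
bounded number of references, and the bins of `P` induce boundedly many bin types, a bin type being
a list of references with multiplicities of at most `L`. The number of copies of each bin type is at
most the number of items. So there are polynomially many choices of references, bin types and
numbers of copies; `candidates` goes through all of them, and fills the resulting compartments by
first fit. One additional bin per item, open to the colour of this item only, takes what overflows.
Since the numbers of copies are enumerated exactly and not rounded, no additive error that depends
on `L` arises.

*Error.* For the choice that comes from `P` (`exists_slotting`), first fit reproduces `P` up to its
overflow. In the colour `c`, this consists of the large items that are exceptional in the grouping,
and of small items of total size at most `2 / L` for each bin of `P` with the colour `c`, because a
compartment rejects a small item only when it is full up to `1 / L` (`Slotting.overflow_le`). Any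
two additional bins of the same colour contain more than `1` together, so the overflow adds at most
`6 / L * P_c + 3` bins (`Fitted.card_additional_le`). Hence each packing `P` has a candidate with
`(1 + 6 / L) * P_c + 3` bins for the colour `c`, and `(1 + 6 * m / L) * P + 3 * m` bins in total
(`exists_candidate`).

*Selection.* The values `OPT(I_c)` are not known to the algorithm. But packing the colours
separately and optimally, and passing to the candidate of this packing, shows that the least span of
`c` among all candidates is at most `(1 + 6 / L) * OPT(I_c) + 3`, and it is at least `OPT(I_c)`. So
the algorithm takes, among the candidates whose spans are at most about `(1 + 6 / L) * β` times the
least ones plus `3`, one with the fewest bins. The candidate of an optimal packing with colour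
stretch `β` competes, which bounds the number of bins (`algorithm_spec`).

*Running time.* `PolyTime f` says that `f` is computed by a program in polynomial time, for the
obvious representations of pairs and lists. Such functions are closed under composition and under
loops over lists whose steps lengthen the state by an amount that is bounded independently of the
state (`PolyTime.foldl`), and the algorithm is put together from these operations.
-/

namespace ColouredBinPacking

/-! ### Polynomial time -/

/-- Types whose elements are represented by values of the programming language. -/
class Enc (α : Type) where
  /-- The value that represents an element. -/
  enc : α → Val

open Enc

instance : Enc ℕ := ⟨Val.num⟩

instance : Enc Bool := ⟨fun b => Val.num b.toNat⟩

instance {α β : Type} [Enc α] [Enc β] : Enc (α × β) := ⟨fun x => Val.pair (enc x.1) (enc x.2)⟩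

instance {α : Type} [Enc α] : Enc (List α) := ⟨fun l => Val.ofList (l.map enc)⟩

/-- The length of the representation of an element. -/
def len {α : Type} [Enc α] (a : α) : ℕ := (enc a).length

/-- The function `f` is computed by a program in polynomial time. Since a program can double its
data in a single step, a polynomial bound on the length of the output is required as well; this is
what makes the notion closed under composition. -/
def PolyTime {α β : Type} [Enc α] [Enc β] (f : α → β) : Prop :=
  ∃ (A : Code) (q : Polynomial ℕ), ∀ a, ∃ t, Eval A (enc a) (enc (f a)) t ∧
    t ≤ q.eval (len a) ∧ len (f a) ≤ q.eval (len a)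

theorem eval_mono (q : Polynomial ℕ) {a b : ℕ} (h : a ≤ b) : q.eval a ≤ q.eval b := by
  rw [Polynomial.eval_eq_sum_range, Polynomial.eval_eq_sum_range]
  gcongr

section
variable {α β γ δ σ : Type} [Enc α] [Enc β] [Enc γ] [Enc δ] [Enc σ]

theorem len_num (n : ℕ) : len n = 1 + n.size := rfl

theorem len_prod (x : α × β) : len x = 1 + len x.1 + len x.2 := rfl

theorem len_nil : len ([] : List α) = 1 := rfl

theorem len_cons (a : α) (l : List α) : len (a :: l) = 1 + len a + len l := rfl

theorem len_bool (b : Bool) : len b ≤ 2 := by cases b <;> decide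

theorem length_le_len (l : List α) : l.length ≤ len l := by
  induction l with
  | nil => simp
  | cons a l ih => rw [len_cons, List.length_cons]; omega

theorem len_le_of_mem {a : α} {l : List α} (h : a ∈ l) : len a ≤ len l := by
  induction l with
  | nil => simp at h
  | cons b l ih =>
    rw [len_cons]
    rcases List.mem_cons.1 h with rfl | h
    · omega
    · have := ih h; omega

theorem len_append (l l' : List α) : len (l ++ l') + 1 = len l + len l' := by
  induction l with
  | nil => simp [len_nil, add_comm]
  | cons a l ih => rw [List.cons_append, len_cons, len_cons]; omega

namespace PolyTime

theorem comp {g : β → γ} {f : α → β} (hg : PolyTime g) (hf : PolyTime f) :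
    PolyTime fun a => g (f a) := by
  obtain ⟨A, p, hA⟩ := hf
  obtain ⟨B, q, hB⟩ := hg
  refine ⟨Code.comp B A, p + q.comp p + 1, fun a => ?_⟩
  obtain ⟨s, h1, h2, h3⟩ := hA a
  obtain ⟨t, h4, h5, h6⟩ := hB (f a)
  have h7 := eval_mono q h3
  refine ⟨_, Eval.comp h1 h4, ?_, ?_⟩ <;> simp <;> omega

theorem id : PolyTime fun a : α => a :=
  ⟨Code.id, Polynomial.X + 1, fun a => ⟨_, Eval.id _, by simp, by simp⟩⟩

theorem of_fst : PolyTime fun x : α × β => x.1 :=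
  ⟨Code.fst, Polynomial.X + 1, fun a => ⟨_, Eval.fst _, by simp, by simp [len_prod]; omega⟩⟩

theorem of_snd : PolyTime fun x : α × β => x.2 :=
  ⟨Code.snd, Polynomial.X + 1, fun a => ⟨_, Eval.snd _, by simp, by simp [len_prod]; omega⟩⟩

theorem fst {f : α → β × γ} (hf : PolyTime f) : PolyTime fun a => (f a).1 := of_fst.comp hf

theorem snd {f : α → β × γ} (hf : PolyTime f) : PolyTime fun a => (f a).2 := of_snd.comp hf

/-- Every value is the output of a program that ignores its input. -/
theorem exists_const_code (w : Val) : ∃ (A : Code) (t : ℕ), ∀ v, Eval A v w t := by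
  induction w with
  | num n => exact ⟨Code.const n, _, fun v => Eval.const n v⟩
  | pair a b iha ihb =>
    obtain ⟨A, s, hA⟩ := iha
    obtain ⟨B, t, hB⟩ := ihb
    exact ⟨Code.pair A B, _, fun v => Eval.pair (hA v) (hB v)⟩

theorem const (b : β) : PolyTime fun _ : α => b := by
  obtain ⟨A, t, hA⟩ := exists_const_code (enc b)
  exact ⟨A, Polynomial.C (t + len b), fun a => ⟨t, hA _, by simp, by simp⟩⟩

theorem pair {f : α → β} {g : α → γ} (hf : PolyTime f) (hg : PolyTime g) :
    PolyTime fun a => (f a, g a) := by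
  obtain ⟨A, p, hA⟩ := hf
  obtain ⟨B, q, hB⟩ := hg
  refine ⟨Code.pair A B, p + q + 1, fun a => ?_⟩
  obtain ⟨s, h1, h2, h3⟩ := hA a
  obtain ⟨t, h4, h5, h6⟩ := hB a
  refine ⟨_, Eval.pair h1 h4, ?_, ?_⟩ <;> simp [len_prod] <;> omega

/-- Lists are represented like iterated pairs. -/
theorem cons {f : α → β} {l : α → List β} (hf : PolyTime f) (hl : PolyTime l) :
    PolyTime fun a => f a :: l a := by
  obtain ⟨A, q, h⟩ := hf.pair hl
  exact ⟨A, q, h⟩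

theorem ite {p : α → Prop} [DecidablePred p] {f g : α → β} (hp : PolyTime fun a => decide (p a))
    (hf : PolyTime f) (hg : PolyTime g) : PolyTime fun a => if p a then f a else g a := by
  obtain ⟨P, r, hP⟩ := hp
  obtain ⟨A, q, hA⟩ := hf
  obtain ⟨B, q', hB⟩ := hg
  refine ⟨Code.cond P A B, q + q' + r + 1, fun a => ?_⟩
  obtain ⟨u, h0, h0', -⟩ := hP a
  obtain ⟨s, h1, h2, h3⟩ := hA a
  obtain ⟨t, h4, h5, h6⟩ := hB a
  by_cases h : p a
  · simp only [if_pos h]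
    refine ⟨_, Eval.condTrue h0 (by simp [h, enc, Val.toNat]) h1, ?_, ?_⟩ <;> simp <;> omega
  · simp only [if_neg h]
    refine ⟨_, Eval.condFalse h0 (by simp [h, enc, Val.toNat]) h4, ?_, ?_⟩ <;> simp <;> omega

theorem headD {l : α → List β} {d : α → β} (hl : PolyTime l) (hd : PolyTime d) :
    PolyTime fun a => (l a).headD (d a) := by
  refine PolyTime.comp (g := fun x : List β × β => x.1.headD x.2) ?_ (hl.pair hd)
  refine ⟨Code.cond (Code.comp Code.isPair Code.fst) (Code.comp Code.fst Code.fst) Code.snd,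
    Polynomial.X + 7, fun x => ?_⟩
  obtain ⟨l, d⟩ := x
  cases l with
  | nil =>
    exact ⟨_, Eval.condFalse (Eval.comp (Eval.fst _) (Eval.isPair _)) rfl (Eval.snd _), by simp,
      by simp [len_prod]; omega⟩
  | cons b l =>
    exact ⟨_, Eval.condTrue (Eval.comp (Eval.fst _) (Eval.isPair _)) one_ne_zero
      (Eval.comp (Eval.fst _) (Eval.fst _)), by simp,
      by simp [len_prod, len_cons]; omega⟩

theorem size_op_le (o : Op) (a b : ℕ) : (o.apply a b).size ≤ a.size + b.size + 1 := by
  rw [Nat.size_le]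
  have ha := Nat.lt_size_self a
  have hb := Nat.lt_size_self b
  have ha' : 1 ≤ 2 ^ a.size := Nat.one_le_two_pow
  have hb' : 1 ≤ 2 ^ b.size := Nat.one_le_two_pow
  have h : 2 ^ (a.size + b.size + 1) = 2 * (2 ^ a.size * 2 ^ b.size) := by ring
  rw [h]
  cases o with
  | add => simp only [Op.apply]; nlinarith
  | sub => simp only [Op.apply]; have := Nat.sub_le a b; nlinarith
  | mul => simp only [Op.apply]; nlinarith [Nat.mul_le_mul ha.le hb.le]
  | le => simp only [Op.apply]; split_ifs <;> nlinarith

theorem op (o : Op) {f g : α → ℕ} (hf : PolyTime f) (hg : PolyTime g) :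
    PolyTime fun a => o.apply (f a) (g a) := by
  refine PolyTime.comp (g := fun x : ℕ × ℕ => o.apply x.1 x.2) ?_ (hf.pair hg)
  refine ⟨Code.op o, Polynomial.X + 1, fun x => ⟨_, Eval.op o _, ?_, ?_⟩⟩
  · simp [enc, Val.fst, Val.snd, Val.toNat, len_prod, len_num]; omega
  · have := size_op_le o x.1 x.2
    simp [len_prod, len_num]; omega

theorem add {f g : α → ℕ} (hf : PolyTime f) (hg : PolyTime g) : PolyTime fun a => f a + g a :=
  op Op.add hf hg

theorem mul {f g : α → ℕ} (hf : PolyTime f) (hg : PolyTime g) : PolyTime fun a => f a * g a :=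
  op Op.mul hf hg

theorem le {f g : α → ℕ} (hf : PolyTime f) (hg : PolyTime g) :
    PolyTime fun a => decide (f a ≤ g a) := by
  obtain ⟨A, q, h⟩ := op Op.le hf hg
  refine ⟨A, q, fun a => ?_⟩
  have h1 := h a
  have h2 : (enc (decide (f a ≤ g a)) : Val) = enc (Op.le.apply (f a) (g a)) := by
    by_cases h : f a ≤ g a <;> simp [h, enc, Op.apply]
  simpa only [len, h2] using h1

theorem and {p q : α → Prop} [DecidablePred p] [DecidablePred q] [∀ a, Decidable (p a ∧ q a)]
    (hp : PolyTime fun a => decide (p a)) (hq : PolyTime fun a => decide (q a)) :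
    PolyTime fun a => decide (p a ∧ q a) := by
  have h := ite hp hq (const false)
  refine cast (congrArg PolyTime (funext fun a => ?_)) h
  by_cases h : p a <;> simp [h]

theorem or {p q : α → Prop} [DecidablePred p] [DecidablePred q] [∀ a, Decidable (p a ∨ q a)]
    (hp : PolyTime fun a => decide (p a)) (hq : PolyTime fun a => decide (q a)) :
    PolyTime fun a => decide (p a ∨ q a) := by
  have h := ite hp (const true) hq
  refine cast (congrArg PolyTime (funext fun a => ?_)) h
  by_cases h : p a <;> simp [h]

theorem of_iff {p q : α → Prop} [DecidablePred p] [DecidablePred q] (h : ∀ a, p a ↔ q a)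
    (hp : PolyTime fun a => decide (p a)) : PolyTime fun a => decide (q a) :=
  cast (congrArg PolyTime (funext fun a => by simp [h a])) hp

theorem eq {f g : α → ℕ} (hf : PolyTime f) (hg : PolyTime g) :
    PolyTime fun a => decide (f a = g a) :=
  of_iff (fun _ => Nat.le_antisymm_iff.symm) ((le hf hg).and (le hg hf))

theorem lt {f g : α → ℕ} (hf : PolyTime f) (hg : PolyTime g) :
    PolyTime fun a => decide (f a < g a) :=
  le (hf.add (const 1)) hg

/-! ### Loops over lists -/

/-- The loop that traverses a list; `N` bounds the lengths of the context `c` and of the list, and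
`Z` those of the states. -/
theorem exists_foldl_code {f : γ → α → σ → σ}
    (hf : PolyTime fun x : γ × α × σ => f x.1 x.2.1 x.2.2) (g : Polynomial ℕ)
    (hg : ∀ c a s, len (f c a s) ≤ len s + g.eval (len c + len a)) :
    ∃ (A : Code) (q : Polynomial ℕ), ∀ (c : γ) (N Z : ℕ) (l : List α) (s : σ),
      len c + len l ≤ N → len s + l.length * g.eval N ≤ Z →
      ∃ t, Eval A (enc (c, l, s)) (enc (c, ([] : List α), l.foldl (fun s a => f c a s) s)) t ∧
        t ≤ l.length * (q.eval (N + Z + 2) + 30) + 10 ∧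
        len (l.foldl (fun s a => f c a s) s) ≤ Z := by
  obtain ⟨A, q, hA⟩ := hf
  refine ⟨Code.loop (Code.comp Code.isPair (Code.comp Code.fst Code.snd))
    (Code.pair Code.fst (Code.pair (Code.comp Code.snd (Code.comp Code.fst Code.snd))
      (Code.comp A (Code.pair Code.fst (Code.pair (Code.comp Code.fst (Code.comp Code.fst Code.snd))
        (Code.comp Code.snd Code.snd)))))), q, fun c N Z l => ?_⟩
  induction l with
  | nil =>
    intro s _ hZ
    exact ⟨_, Eval.loopStop (Eval.comp (Eval.comp (Eval.snd _) (Eval.fst _)) (Eval.isPair _)) rfl,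
      by simp, by simpa using hZ⟩
  | cons a l ih =>
    intro s hN hZ
    rw [len_cons] at hN
    rw [List.length_cons, Nat.succ_mul] at hZ
    have h1 := hg c a s
    have h2 : g.eval (len c + len a) ≤ g.eval N := eval_mono g (by omega)
    obtain ⟨t, h3, h4, h5⟩ := ih (f c a s) (by omega) (by omega)
    obtain ⟨r, h6, h7, -⟩ := hA (c, a, s)
    refine ⟨_, Eval.loopStep
      (Eval.comp (Eval.comp (Eval.snd _) (Eval.fst _)) (Eval.isPair _)) one_ne_zero
      (Eval.pair (Eval.fst _) (Eval.pair (Eval.comp (Eval.comp (Eval.snd _) (Eval.fst _))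
        (Eval.snd _)) (Eval.comp (Eval.pair (Eval.fst _) (Eval.pair
          (Eval.comp (Eval.comp (Eval.snd _) (Eval.fst _)) (Eval.fst _))
          (Eval.comp (Eval.snd _) (Eval.snd _)))) h6))) h3, ?_, h5⟩
    have h8 : q.eval (len (c, a, s)) ≤ q.eval (N + Z + 2) :=
      eval_mono q (by simp only [len_prod]; omega)
    rw [List.length_cons, Nat.succ_mul]
    omega

/-- Loops over lists stay polynomial when no step lengthens the state by more than a polynomial in
the lengths of the context and of the list element, whatever the state is. -/
theorem foldl {f : γ → α → σ → σ} {l : γ → List α} {s : γ → σ}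
    (hf : PolyTime fun x : γ × α × σ => f x.1 x.2.1 x.2.2) (hl : PolyTime l) (hs : PolyTime s)
    (hg : ∃ g : Polynomial ℕ, ∀ c a s, len (f c a s) ≤ len s + g.eval (len c + len a)) :
    PolyTime fun c => (l c).foldl (fun s a => f c a s) (s c) := by
  obtain ⟨g, hg⟩ := hg
  obtain ⟨A, q, hA⟩ := exists_foldl_code hf g hg
  obtain ⟨B, p, hB⟩ := PolyTime.id.pair (hl.pair hs)
  refine ⟨Code.comp (Code.comp Code.snd Code.snd) (Code.comp A B),
    p + (p + p * g.comp p) + (p * (q.comp (p + (p + p * g.comp p) + 2) + 30) + 10) + 10,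
    fun c => ?_⟩
  obtain ⟨t, h1, h2, h3⟩ := hB c
  have h4 := h3
  simp only [len_prod] at h4
  have h5 := length_le_len (l c)
  have h6 : (l c).length * g.eval (p.eval (len c)) ≤ p.eval (len c) * g.eval (p.eval (len c)) :=
    Nat.mul_le_mul_right _ (by omega)
  obtain ⟨r, h7, h8, h9⟩ := hA c (p.eval (len c))
    (p.eval (len c) + p.eval (len c) * g.eval (p.eval (len c))) (l c) (s c) (by omega) (by omega)
  have h10 := h8.trans (Nat.add_le_add_right (Nat.mul_le_mul_right _
    (show (l c).length ≤ p.eval (len c) by omega)) _)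
  refine ⟨_, Eval.comp (Eval.comp h1 h7) (Eval.comp (Eval.snd _) (Eval.snd _)), ?_, ?_⟩
  · simp only [Polynomial.eval_add, Polynomial.eval_mul, Polynomial.eval_comp,
      Polynomial.eval_ofNat]
    omega
  · simp only [Polynomial.eval_add, Polynomial.eval_mul, Polynomial.eval_comp,
      Polynomial.eval_ofNat]
    omega

theorem reverse {l : γ → List α} (hl : PolyTime l) : PolyTime fun c => (l c).reverse := by
  have h : PolyTime fun c => (l c).foldl (fun s a => a :: s) [] := by
    refine foldl (f := fun _ a s => a :: s) (of_snd.fst.cons of_snd.snd) hl (const [])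
      ⟨Polynomial.X + 1, fun c a s => ?_⟩
    simp [len_cons]; omega
  simpa using h

theorem foldr {f : γ → α → σ → σ} {l : γ → List α} {s : γ → σ}
    (hf : PolyTime fun x : γ × α × σ => f x.1 x.2.1 x.2.2) (hl : PolyTime l) (hs : PolyTime s)
    (hg : ∃ g : Polynomial ℕ, ∀ c a s, len (f c a s) ≤ len s + g.eval (len c + len a)) :
    PolyTime fun c => (l c).foldr (f c) (s c) := by
  simpa using foldl hf hl.reverse hs hg

theorem map {f : γ → α → β} {l : γ → List α} (hf : PolyTime fun x : γ × α => f x.1 x.2)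
    (hl : PolyTime l) : PolyTime fun c => (l c).map (f c) := by
  have h : PolyTime fun c => (l c).foldr (fun a s => f c a :: s) [] := by
    refine foldr (f := fun c a s => f c a :: s)
      ((hf.comp (of_fst.pair of_snd.fst)).cons of_snd.snd) hl (const []) ?_
    obtain ⟨_, q, hq⟩ := hf
    refine ⟨q.comp (Polynomial.X + 1) + 1, fun c a s => ?_⟩
    obtain ⟨-, -, -, h⟩ := hq (c, a)
    rw [len_prod, add_comm 1, add_right_comm] at h
    simp [len_cons] at h ⊢
    omega
  simpa [← List.map_eq_foldr] using h

theorem append {l l' : γ → List α} (hl : PolyTime l) (hl' : PolyTime l') :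
    PolyTime fun c => l c ++ l' c := by
  have h : PolyTime fun c => (l c).foldr (fun a s => a :: s) (l' c) := by
    refine foldr (f := fun _ a s => a :: s) (of_snd.fst.cons of_snd.snd) hl hl'
      ⟨Polynomial.X + 1, fun c a s => ?_⟩
    simp [len_cons]; omega
  simpa using h

theorem flatMap {f : γ → α → List β} {l : γ → List α} (hf : PolyTime fun x : γ × α => f x.1 x.2)
    (hl : PolyTime l) : PolyTime fun c => (l c).flatMap (f c) := by
  have h : PolyTime fun c => (l c).foldr (fun a s => f c a ++ s) [] := by
    refine foldr (f := fun c a s => f c a ++ s)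
      ((hf.comp (of_fst.pair of_snd.fst)).append of_snd.snd) hl (const []) ?_
    obtain ⟨_, q, hq⟩ := hf
    refine ⟨q.comp (Polynomial.X + 1), fun c a s => ?_⟩
    obtain ⟨-, -, -, h⟩ := hq (c, a)
    have := len_append (f c a) s
    rw [len_prod, add_comm 1, add_right_comm] at h
    simp at h ⊢
    omega
  refine cast (congrArg PolyTime (funext fun c => ?_)) h
  induction l c with
  | nil => rfl
  | cons a l ih => simp [ih]

theorem filter {p : γ → α → Prop} [∀ c a, Decidable (p c a)] {l : γ → List α}
    (hp : PolyTime fun x : γ × α => decide (p x.1 x.2)) (hl : PolyTime l) :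
    PolyTime fun c => (l c).filter fun a => p c a := by
  have h := flatMap (f := fun c a => if p c a then [a] else [])
    (ite hp (of_snd.cons (const [])) (const [])) hl
  refine cast (congrArg PolyTime (funext fun c => ?_)) h
  induction l c with
  | nil => rfl
  | cons a l ih => by_cases h : p c a <;> simp [ih, h]

theorem forall_mem {p : γ → α → Prop} [∀ c a, Decidable (p c a)] {l : γ → List α}
    [∀ c, Decidable (∀ a ∈ l c, p c a)]
    (hp : PolyTime fun x : γ × α => decide (p x.1 x.2)) (hl : PolyTime l) :
    PolyTime fun c => decide (∀ a ∈ l c, p c a) := by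
  have h := foldr (f := fun c a s => if p c a then s else false) (s := fun _ => true)
    (ite (hp.comp (of_fst.pair of_snd.fst)) of_snd.snd (const false)) hl (const true)
    ⟨2, fun c a s => (len_bool _).trans (by simp)⟩
  refine cast (congrArg PolyTime (funext fun c => ?_)) h
  have : ∀ l : List α, List.foldr (fun a s => if p c a then s else false) true l = true ↔
      ∀ a ∈ l, p c a := by
    intro l
    induction l with
    | nil => simp
    | cons a l ih =>
      rw [List.foldr_cons, List.forall_mem_cons, ← ih]
      by_cases h : p c a <;> simp [h]
  exact Bool.eq_iff_iff.2 (by rw [this]; simp)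

theorem sum {l : γ → List ℕ} (hl : PolyTime l) : PolyTime fun c => (l c).sum := by
  have h := foldr (f := fun _ a s => a + s) (s := fun _ => 0)
    (of_snd.fst.add of_snd.snd) hl (const 0)
    ⟨Polynomial.X + 1, fun c a s => by
      have := size_op_le Op.add a s
      simp only [Op.apply] at this
      simp [len_num]; omega⟩
  simpa [List.sum] using h

theorem prod {l : γ → List ℕ} (hl : PolyTime l) : PolyTime fun c => (l c).prod := by
  have h := foldr (f := fun _ a s => a * s) (s := fun _ => 1)
    (of_snd.fst.mul of_snd.snd) hl (const 1)
    ⟨Polynomial.X + 1, fun c a s => by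
      have := size_op_le Op.mul a s
      simp only [Op.apply] at this
      simp [len_num]; omega⟩
  simpa [List.prod] using h

theorem length {l : γ → List α} (hl : PolyTime l) : PolyTime fun c => (l c).length := by
  have h := sum (map (f := fun _ _ => 1) (const 1) hl)
  simpa using h

end PolyTime
end

/-! ### The algorithm -/

/-- The elements of a list, each with the number of elements behind it. -/
def number {α : Type} (l : List α) : List (ℕ × α) :=
  l.foldr (fun a s => (s.length, a) :: s) []

/-- All lists of at most `k` elements of `l`. -/
def choices {α : Type} : ℕ → List α → List (List α)
  | 0, _ => [[]]
  | k + 1, l => [] :: l.flatMap fun a => (choices k l).map fun t => a :: t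

/-- A list with the same elements and without repetitions. -/
def distinct (l : List ℕ) : List ℕ :=
  l.foldr (fun a s => if ∀ b ∈ s, ¬ b = a then a :: s else s) []

/-- The product of the denominators of the sizes; an item is a triple of its colour and the
numerator and denominator of its size. -/
def denom (I : List (ℕ × ℕ × ℕ)) : ℕ := (I.map fun e => e.2.2).prod

/-- The items as pairs of a colour and a size, all sizes being multiplied by `L * denom I`. -/
def scaled (L : ℕ) (I : List (ℕ × ℕ × ℕ)) : List (ℕ × ℕ) :=
  (number I).map fun x => (x.2.1, L * x.2.2.1 *
    ((number I).map fun y => if y.1 = x.1 then 1 else y.2.2.2).prod)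

/-- The least size among the references `R` that have the colour of `e` and are not smaller than
`e`, and `D + 1` if there are none. References are pairs of a colour and a size. -/
def unit (D : ℕ) (R : List (ℕ × ℕ)) (e : ℕ × ℕ) : ℕ :=
  (R.filter fun r => r.1 = e.1 ∧ e.2 ≤ r.2).foldr (fun r u => min r.2 u) (D + 1)

/-- The items as triples of a colour, the size of their reference and their size. -/
def classed (D : ℕ) (R : List (ℕ × ℕ)) (X : List (ℕ × ℕ)) : List (ℕ × ℕ × ℕ) :=
  X.map fun e => (e.1, unit D R e, e.2)

/-- A compartment `(b, (c, u), k)` belongs to the bin `b`, has capacity `k`, and is meant for items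
of colour `c` with a reference of size `u`; the value `u = D + 1` marks a compartment for all items
of colour `c`. -/
abbrev Compartment : Type := ℕ × (ℕ × ℕ) × ℕ

/-- The compartment is meant for the item. -/
abbrev Accepts (D : ℕ) (κ : Compartment) (e : ℕ × ℕ × ℕ) : Prop :=
  κ.2.1.1 = e.1 ∧ (κ.2.1.2 = e.2.1 ∨ κ.2.1.2 = D + 1)

/-- The total size of the items that the assignment `A` puts into the compartment `κ`. -/
def used (A : List (Compartment × ℕ × ℕ × ℕ)) (κ : Compartment) : ℕ :=
  (A.map fun x => if x.1.1 = κ.1 ∧ (x.1.2.1.1 = κ.2.1.1 ∧ x.1.2.1.2 = κ.2.1.2) ∧ x.1.2.2 = κ.2.2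
    then x.2.2.2 else 0).sum

/-- The first compartment that has room for the item `e`. -/
def place (D : ℕ) (K : List Compartment) (A : List (Compartment × ℕ × ℕ × ℕ)) (e : ℕ × ℕ × ℕ) :
    Compartment :=
  (K.filter fun κ => Accepts D κ e ∧ used A κ + e.2.2 ≤ κ.2.2).headD (0, (0, 0), 0)

/-- First fit: the items, from the last one to the first one, go into the first compartment that
has room for them. -/
def firstFit (D : ℕ) (K : List Compartment) (Y : List (ℕ × ℕ × ℕ)) :
    List (Compartment × ℕ × ℕ × ℕ) :=
  Y.foldr (fun e A => (place D K A e, e) :: A) []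

/-- A bin type is a list of references with multiplicities. The list `bl` gives bin types with
their numbers of copies, and the layout is the list of all copies. -/
def layout (X : List (ℕ × ℕ)) (bl : List (List ((ℕ × ℕ) × ℕ) × ℕ)) : List (List ((ℕ × ℕ) × ℕ)) :=
  bl.flatMap fun b => ((number X).filter fun x => x.1 < b.2).map fun _ => b.1

/-- The bins with their compartments: the bins of the layout, and for each item an additional bin
for items of its colour. -/
def bins (D : ℕ) (X : List (ℕ × ℕ)) (bl : List (List ((ℕ × ℕ) × ℕ) × ℕ)) :
    List (List ((ℕ × ℕ) × ℕ)) :=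
  ((layout X bl).map fun a => a.map fun r => (r.1, r.2 * r.1.2)) ++
    X.map fun e => [((e.1, D + 1), D)]

/-- The compartments of all bins. -/
def compartments (D : ℕ) (X : List (ℕ × ℕ)) (bl : List (List ((ℕ × ℕ) × ℕ) × ℕ)) :
    List Compartment :=
  (number (bins D X bl)).flatMap fun x => x.2.map fun κ => (x.1, κ)

/-- The assignment found by first fit, as a list of triples of a bin, and the colour and the size of
an item. -/
def pack (D : ℕ) (X R : List (ℕ × ℕ)) (bl : List (List ((ℕ × ℕ) × ℕ) × ℕ)) : List (ℕ × ℕ × ℕ) :=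
  (firstFit D (compartments D X bl) (classed D R X)).map fun x => (x.1.1, x.2.1, x.2.2.2)

/-- The items in each bin have total size at most `D`. -/
abbrev Fits (D : ℕ) (a : List (ℕ × ℕ × ℕ)) : Prop :=
  ∀ x ∈ a, (a.map fun y => if y.1 = x.1 then y.2.2 else 0).sum ≤ D

/-- The number of bins of an assignment. -/
def numBins (a : List (ℕ × ℕ × ℕ)) : ℕ := (distinct (a.map fun x => x.1)).length

/-- The number of bins of an assignment that contain an item of colour `c`. -/
def numSpan (c : ℕ) (a : List (ℕ × ℕ × ℕ)) : ℕ :=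
  (distinct ((a.filter fun x => x.2.1 = c).map fun x => x.1)).length

/-- The candidates: first fit into compartments, for all choices of at most `T` references, all
choices of at most `M` bin types with at most `T` different references, each with multiplicity at
most `L`, and all numbers of copies of these bin types. -/
def candidates (m L T M : ℕ) (I : List (ℕ × ℕ × ℕ)) : List (List (ℕ × ℕ × ℕ)) :=
  ((choices T ((List.range m).map (fun c => (c, denom I)) ++ scaled L I)).flatMap fun R =>
    (choices M ((choices T (R.flatMap fun r => (List.range (L + 1)).map fun k => (r, k))).flatMap
      fun a => ((scaled L I).length :: (number (scaled L I)).map fun x => x.1).map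
        fun k => (a, k))).map fun bl => pack (L * denom I) (scaled L I) R bl).filter
    fun a => Fits (L * denom I) a

/-- The candidates whose spans are, for each colour, not much larger than `N / L` times the least
span among all candidates. -/
def balanced (m L N : ℕ) (S : List (List (ℕ × ℕ × ℕ))) : List (List (ℕ × ℕ × ℕ)) :=
  S.filter fun a => ∀ b ∈ S, ∀ c ∈ List.range m, L * numSpan c a ≤ N * numSpan c b + 3 * L

/-- An assignment with the least number of bins. -/
def fewestBins (S : List (List (ℕ × ℕ × ℕ))) : List (ℕ × ℕ × ℕ) :=
  (S.filter fun a => ∀ b ∈ S, numBins a ≤ numBins b).headD []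

/-- The algorithm: a balanced candidate with the least number of bins. -/
def algorithm (m L T M N : ℕ) (I : List (ℕ × ℕ × ℕ)) : List ℕ :=
  (fewestBins (balanced m L N (candidates m L T M I))).map fun x => x.1

/-! ### The running time of the algorithm -/

namespace PolyTime

variable {α γ : Type} [Enc α] [Enc γ]

theorem not {p : γ → Prop} [DecidablePred p] [∀ a, Decidable (¬ p a)]
    (hp : PolyTime fun a => decide (p a)) : PolyTime fun a => decide (¬ p a) := by
  have h := ite hp (const false) (const true)
  refine cast (congrArg PolyTime (funext fun a => ?_)) h
  by_cases h : p a <;> simp [h]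

theorem min {f g : γ → ℕ} (hf : PolyTime f) (hg : PolyTime g) :
    PolyTime fun a => min (f a) (g a) := by
  simpa only [min_def] using ite (le hf hg) hf hg

theorem number {l : γ → List α} (hl : PolyTime l) : PolyTime fun c => number (l c) := by
  -- The running index is capped by the length of the whole list, so that the growth of the state
  -- in one step is bounded in terms of the list alone.
  have h := foldr (γ := γ × List α) (l := fun x => x.2) (s := fun _ => ([] : List (ℕ × α)))
    (f := fun c a s => (Min.min s.length c.2.length, a) :: s)
    (((of_snd.snd.length.min of_fst.snd.length).pair of_snd.fst).cons of_snd.snd)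
    of_snd (const [])
    ⟨Polynomial.X + 3, fun c a s => by
      have h1 : (Min.min s.length c.2.length).size ≤ c.2.length :=
        (Nat.size_le_size (min_le_right _ _)).trans (Nat.size_le.2 Nat.lt_two_pow_self)
      have h2 := length_le_len c.2
      simp only [len_cons, len_prod, len_num, Polynomial.eval_add, Polynomial.eval_X,
        Polynomial.eval_ofNat]
      omega⟩
  refine cast (congrArg PolyTime (funext fun c => ?_)) (h.comp (PolyTime.id.pair hl))
  have key : ∀ (N : ℕ) (l : List α), l.length ≤ N →
      l.foldr (fun a s => (Min.min s.length N, a) :: s) [] =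
        ColouredBinPacking.number l ∧ (ColouredBinPacking.number l).length = l.length := by
    intro N l
    induction l with
    | nil => intro _; exact ⟨rfl, rfl⟩
    | cons a l ih =>
      intro hN
      rw [List.length_cons] at hN
      obtain ⟨h1, h2⟩ := ih (by omega)
      rw [List.foldr_cons, h1, h2, min_eq_left (by omega)]
      simp only [ColouredBinPacking.number, List.foldr_cons, List.length_cons] at h2 ⊢
      rw [h2]
      exact ⟨rfl, rfl⟩
  exact (key _ _ le_rfl).1

theorem choices (k : ℕ) {l : γ → List α} (hl : PolyTime l) :
    PolyTime fun c => choices k (l c) := by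
  induction k with
  | zero => exact const _
  | succ k ih =>
    exact (const []).cons (flatMap (map (of_fst.snd.cons of_snd) (ih.comp of_fst)) hl)

theorem distinct {l : γ → List ℕ} (hl : PolyTime l) : PolyTime fun c => distinct (l c) := by
  refine foldr (f := fun _ a s => if ∀ b ∈ s, ¬ b = a then a :: s else s) ?_ hl (const [])
    ⟨Polynomial.X + 1, fun c a s => ?_⟩
  · exact ite (forall_mem (eq of_snd of_fst.snd.fst).not of_snd.snd)
      (of_snd.fst.cons of_snd.snd) of_snd.snd
  · simp only [Polynomial.eval_add, Polynomial.eval_X, Polynomial.eval_one]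
    split_ifs
    · rw [len_cons]; omega
    · omega

theorem denom {I : γ → List (ℕ × ℕ × ℕ)} (hI : PolyTime I) : PolyTime fun c => denom (I c) :=
  prod (map of_snd.snd.snd hI)

theorem scaled (L : ℕ) {I : γ → List (ℕ × ℕ × ℕ)} (hI : PolyTime I) :
    PolyTime fun c => scaled L (I c) := by
  refine map (of_snd.snd.fst.pair (((const L).mul of_snd.snd.snd.fst).mul
    (prod (map (ite (eq of_snd.fst of_fst.snd.fst) (const 1) of_snd.snd.snd.snd)
      (number (hI.comp of_fst)))))) (number hI)

theorem unit {D : γ → ℕ} {R : γ → List (ℕ × ℕ)} {e : γ → ℕ × ℕ} (hD : PolyTime D)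
    (hR : PolyTime R) (he : PolyTime e) : PolyTime fun c => unit (D c) (R c) (e c) := by
  refine foldr (f := fun _ r u => Min.min r.2 u) (of_snd.fst.snd.min of_snd.snd)
    (filter (p := fun c r => r.1 = (e c).1 ∧ (e c).2 ≤ r.2)
      ((eq of_snd.fst (he.comp of_fst).fst).and (le (he.comp of_fst).snd of_snd.snd)) hR)
    (hD.add (const 1)) ⟨0, fun c r u => ?_⟩
  have := Nat.size_le_size (min_le_right r.2 u)
  simp only [len_num, Polynomial.eval_zero]
  omega

theorem classed {D : γ → ℕ} {R X : γ → List (ℕ × ℕ)} (hD : PolyTime D)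
    (hR : PolyTime R) (hX : PolyTime X) : PolyTime fun c => classed (D c) (R c) (X c) :=
  map (of_snd.fst.pair ((unit (hD.comp of_fst) (hR.comp of_fst) of_snd).pair of_snd.snd)) hX

theorem used {A : γ → List (Compartment × ℕ × ℕ × ℕ)} {κ : γ → Compartment} (hA : PolyTime A)
    (hκ : PolyTime κ) : PolyTime fun c => used (A c) (κ c) :=
  have h : PolyTime fun x : γ × Compartment × ℕ × ℕ × ℕ => κ x.1 := hκ.comp of_fst
  sum (map (ite ((eq of_snd.fst.fst h.fst).and
    (((eq of_snd.fst.snd.fst.fst h.snd.fst.fst).and (eq of_snd.fst.snd.fst.snd h.snd.fst.snd)).and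
      (eq of_snd.fst.snd.snd h.snd.snd))) of_snd.snd.snd.snd (const 0)) hA)

theorem place {D : γ → ℕ} {K : γ → List Compartment} {A : γ → List (Compartment × ℕ × ℕ × ℕ)}
    {e : γ → ℕ × ℕ × ℕ} (hD : PolyTime D) (hK : PolyTime K) (hA : PolyTime A) (he : PolyTime e) :
    PolyTime fun c => place (D c) (K c) (A c) (e c) := by
  have h : PolyTime fun x : γ × Compartment => e x.1 := he.comp of_fst
  exact headD (filter (((eq of_snd.snd.fst.fst h.fst).and ((eq of_snd.snd.fst.snd h.snd.fst).or
    (eq of_snd.snd.fst.snd ((hD.comp of_fst).add (const 1))))).and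
      (le ((used (hA.comp of_fst) of_snd).add h.snd.snd) of_snd.snd.snd)) hK) (const _)

theorem firstFit {D : γ → ℕ} {K : γ → List Compartment} {Y : γ → List (ℕ × ℕ × ℕ)}
    (hD : PolyTime D) (hK : PolyTime K) (hY : PolyTime Y) :
    PolyTime fun c => firstFit (D c) (K c) (Y c) := by
  have h := foldr (γ := (ℕ × List Compartment) × List (ℕ × ℕ × ℕ)) (l := fun x => x.2)
    (f := fun c e A => (ColouredBinPacking.place c.1.1 c.1.2 A e, e) :: A) (s := fun _ => [])
    (((place of_fst.fst.fst of_fst.fst.snd of_snd.snd of_snd.fst).pair of_snd.fst).cons of_snd.snd)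
    of_snd (const [])
    ⟨Polynomial.X + Polynomial.C (len ((0, (0, 0), 0) : Compartment) + 2), fun c e A => ?_⟩
  · exact h.comp ((hD.pair hK).pair hY)
  · have h1 : len (ColouredBinPacking.place c.1.1 c.1.2 A e) ≤
        len c.1.2 + len ((0, (0, 0), 0) : Compartment) := by
      rw [ColouredBinPacking.place, List.headD_eq_head?_getD]
      cases h : (List.filter (fun κ => decide (Accepts c.1.1 κ e ∧
        ColouredBinPacking.used A κ + e.2.2 ≤ κ.2.2)) c.1.2).head? with
      | none => exact Nat.le_add_left _ _
      | some κ =>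
        exact (len_le_of_mem (List.mem_of_mem_filter (List.mem_of_mem_head? h))).trans
          (Nat.le_add_right _ _)
    rw [len_cons, len_prod, Polynomial.eval_add, Polynomial.eval_X, Polynomial.eval_C, len_prod c,
      len_prod c.1]
    simp only at h1 ⊢
    omega

theorem layout {X : γ → List (ℕ × ℕ)} {bl : γ → List (List ((ℕ × ℕ) × ℕ) × ℕ)}
    (hX : PolyTime X) (hbl : PolyTime bl) : PolyTime fun c => layout (X c) (bl c) :=
  flatMap (map of_fst.snd.fst (filter (lt of_snd.fst of_fst.snd.snd) (number (hX.comp of_fst)))) hbl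

theorem bins {D : γ → ℕ} {X : γ → List (ℕ × ℕ)} {bl : γ → List (List ((ℕ × ℕ) × ℕ) × ℕ)}
    (hD : PolyTime D) (hX : PolyTime X) (hbl : PolyTime bl) :
    PolyTime fun c => bins (D c) (X c) (bl c) :=
  append (map (map (of_snd.fst.pair (of_snd.snd.mul of_snd.fst.snd)) of_snd) (layout hX hbl))
    (map (((of_snd.fst.pair ((hD.comp of_fst).add (const 1))).pair (hD.comp of_fst)).cons
      (const [])) hX)

theorem compartments {D : γ → ℕ} {X : γ → List (ℕ × ℕ)}
    {bl : γ → List (List ((ℕ × ℕ) × ℕ) × ℕ)} (hD : PolyTime D) (hX : PolyTime X)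
    (hbl : PolyTime bl) : PolyTime fun c => compartments (D c) (X c) (bl c) :=
  flatMap (map (of_fst.snd.fst.pair of_snd) of_snd.snd) (number (bins hD hX hbl))

theorem pack {D : γ → ℕ} {X R : γ → List (ℕ × ℕ)} {bl : γ → List (List ((ℕ × ℕ) × ℕ) × ℕ)}
    (hD : PolyTime D) (hX : PolyTime X) (hR : PolyTime R) (hbl : PolyTime bl) :
    PolyTime fun c => pack (D c) (X c) (R c) (bl c) :=
  map (of_snd.fst.fst.pair (of_snd.snd.fst.pair of_snd.snd.snd.snd))
    (firstFit hD (compartments hD hX hbl) (classed hD hR hX))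

theorem fits {D : γ → ℕ} {a : γ → List (ℕ × ℕ × ℕ)} (hD : PolyTime D) (ha : PolyTime a) :
    PolyTime fun c => decide (Fits (D c) (a c)) :=
  forall_mem (le (sum (map (ite (eq of_snd.fst of_fst.snd.fst) of_snd.snd.snd (const 0))
    (ha.comp of_fst))) (hD.comp of_fst)) ha

theorem numBins {a : γ → List (ℕ × ℕ × ℕ)} (ha : PolyTime a) : PolyTime fun c => numBins (a c) :=
  length (distinct (map of_snd.fst ha))

theorem numSpan {d : γ → ℕ} {a : γ → List (ℕ × ℕ × ℕ)} (hd : PolyTime d) (ha : PolyTime a) :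
    PolyTime fun c => numSpan (d c) (a c) :=
  length (distinct (map of_snd.fst (filter (eq of_snd.snd.fst (hd.comp of_fst)) ha)))

theorem candidates (m L T M : ℕ) {I : γ → List (ℕ × ℕ × ℕ)} (hI : PolyTime I) :
    PolyTime fun c => candidates m L T M (I c) := by
  have hD : PolyTime fun c => L * ColouredBinPacking.denom (I c) := (const L).mul (denom hI)
  have hX := scaled L hI
  refine filter (fits (hD.comp of_fst) of_snd) (flatMap (map ?_ ?_) (choices T ?_))
  · exact pack (hD.comp of_fst.fst) (hX.comp of_fst.fst) of_fst.snd of_snd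
  · refine choices M (flatMap (map (of_fst.snd.pair of_snd) ?_) (choices T ?_))
    · exact cons (length (hX.comp of_fst.fst)) (map of_snd.fst (number (hX.comp of_fst.fst)))
    · exact flatMap (map (of_fst.snd.pair of_snd) (const _)) of_snd
  · exact append (map (of_snd.pair ((denom hI).comp of_fst)) (const _)) hX

theorem balanced (m L N : ℕ) {S : γ → List (List (ℕ × ℕ × ℕ))} (hS : PolyTime S) :
    PolyTime fun c => balanced m L N (S c) :=
  filter (forall_mem (forall_mem
    (le ((const L).mul (numSpan of_snd of_fst.fst.snd))
      (((const N).mul (numSpan of_snd of_fst.snd)).add (const (3 * L)))) (const _))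
    (hS.comp of_fst)) hS

theorem fewestBins {S : γ → List (List (ℕ × ℕ × ℕ))} (hS : PolyTime S) :
    PolyTime fun c => fewestBins (S c) :=
  headD (filter (forall_mem (le (numBins of_fst.snd) (numBins of_snd)) (hS.comp of_fst)) hS)
    (const [])

theorem algorithm (m L T M N : ℕ) : PolyTime (algorithm m L T M N) :=
  map of_snd.fst (fewestBins (balanced m L N (candidates m L T M PolyTime.id)))

end PolyTime

/-! ### Lists -/

section
variable {α β : Type}

theorem number_cons (a : α) (l : List α) :
    number (a :: l) = ((number l).length, a) :: number l := rfl

theorem length_number (l : List α) : (number l).length = l.length := by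
  induction l with
  | nil => rfl
  | cons a l ih => rw [number_cons, List.length_cons, ih, List.length_cons]

theorem map_snd_number (l : List α) : (number l).map (fun x => x.2) = l := by
  induction l with
  | nil => rfl
  | cons a l ih => rw [number_cons, List.map_cons, ih]

theorem fst_lt_of_mem_number {l : List α} {x : ℕ × α} (h : x ∈ number l) : x.1 < l.length := by
  induction l with
  | nil => simp [number] at h
  | cons a l ih =>
    rw [number_cons, List.mem_cons, length_number] at h
    rw [List.length_cons]
    rcases h with rfl | h
    · simp
    · have := ih h; omega

theorem number_map (f : α → β) (l : List α) :
    number (l.map f) = (number l).map fun x => (x.1, f x.2) := by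
  induction l with
  | nil => rfl
  | cons a l ih => simp only [List.map_cons, number_cons, ih, List.length_map]

/-- The numbering of a list without repetitions is an injective function of its elements. -/
theorem exists_number_eq {l : List α} (h : l.Nodup) :
    ∃ ν : α → ℕ, number l = l.map (fun a => (ν a, a)) ∧ ∀ a ∈ l, ∀ b ∈ l, ν a = ν b → a = b := by
  classical
  induction l with
  | nil => exact ⟨fun _ => 0, rfl, by simp⟩
  | cons a l ih =>
    rw [List.nodup_cons] at h
    obtain ⟨ν, h1, h2⟩ := ih h.2
    have h3 : ∀ b ∈ l, ν b < l.length := fun b hb => by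
      have : (ν b, b) ∈ number l := by rw [h1]; exact List.mem_map.2 ⟨b, hb, rfl⟩
      exact fst_lt_of_mem_number this
    have h4 : ∀ b ∈ l, Function.update ν a l.length b = ν b := fun b hb =>
      Function.update_of_ne (fun hba : b = a => h.1 (hba ▸ hb)) _ _
    refine ⟨Function.update ν a l.length, ?_, ?_⟩
    · rw [number_cons, List.map_cons, length_number, Function.update_self, h1]
      congr 1
      exact List.map_congr_left fun b hb => by rw [h4 b hb]
    · intro b hb b' hb' hbb
      rcases List.mem_cons.1 hb with rfl | hb1 <;> rcases List.mem_cons.1 hb' with rfl | hb2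
      · rfl
      · rw [Function.update_self, h4 _ hb2] at hbb
        exact absurd hbb (h3 _ hb2).ne'
      · rw [Function.update_self, h4 _ hb1] at hbb
        exact absurd hbb (h3 _ hb1).ne
      · rw [h4 _ hb1, h4 _ hb2] at hbb
        exact h2 _ hb1 _ hb2 hbb

theorem length_filter_number (l : List α) (k : ℕ) :
    ((number l).filter fun x => x.1 < k).length = min k l.length := by
  induction l with
  | nil => simp [number]
  | cons a l ih =>
    rw [number_cons, List.filter_cons, length_number, List.length_cons]
    by_cases h : l.length < k
    · simp only [h, decide_true, if_true, List.length_cons, ih]; omega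
    · simp only [h, decide_false, Bool.false_eq_true, if_false, ih]; omega

theorem mem_number_fst {l : List α} {k : ℕ} (h : k < l.length) :
    k ∈ (number l).map (fun x => x.1) := by
  induction l with
  | nil => simp at h
  | cons a l ih =>
    rw [number_cons, List.map_cons, length_number, List.mem_cons]
    rw [List.length_cons] at h
    by_cases hk : k = l.length
    · exact Or.inl hk
    · exact Or.inr (ih (by omega))

theorem prod_map_number_mul {l : List α} (f : α → ℕ) {x : ℕ × α} (h : x ∈ number l) :
    ((number l).map fun y => if y.1 = x.1 then 1 else f y.2).prod * f x.2 = (l.map f).prod := by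
  induction l with
  | nil => simp [number] at h
  | cons a l ih =>
    rw [number_cons, List.mem_cons] at h
    rw [number_cons, List.map_cons, List.prod_cons, List.map_cons, List.prod_cons]
    by_cases hx : (number l).length = x.1
    · have hx' : x = ((number l).length, a) := by
        rcases h with h | h
        · exact h
        · have := fst_lt_of_mem_number h
          rw [length_number] at hx; omega
      have h1 : (number l).map (fun y => if y.1 = x.1 then 1 else f y.2) =
          (number l).map fun y => f y.2 := by
        refine List.map_congr_left fun y hy => if_neg fun hyx => ?_
        have := fst_lt_of_mem_number hy
        rw [length_number] at hx; omega
      have h2 : (number l).map (fun y => f y.2) = l.map f := by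
        conv_rhs => rw [← map_snd_number l, List.map_map]
        rfl
      rw [h1, h2, if_pos hx, hx', one_mul, mul_comm]
    · have h' : x ∈ number l := by
        rcases h with h | h
        · exact absurd (by rw [h]) hx
        · exact h
      rw [if_neg hx, mul_assoc, ih h']

theorem mem_choices {k : ℕ} {l t : List α} : t ∈ choices k l ↔ t.length ≤ k ∧ ∀ a ∈ t, a ∈ l := by
  induction k generalizing t with
  | zero =>
    rw [choices, List.mem_singleton, Nat.le_zero, List.length_eq_zero_iff]
    exact ⟨fun h => ⟨h, by simp [h]⟩, fun h => h.1⟩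
  | succ k ih =>
    cases t with
    | nil => simp [choices]
    | cons a t => simp [choices, ih]; tauto

theorem length_distinct (l : List ℕ) : (distinct l).length = l.toFinset.card := by
  have h : (distinct l).Nodup ∧ ∀ x, x ∈ distinct l ↔ x ∈ l := by
    induction l with
    | nil => exact ⟨List.nodup_nil, fun _ => Iff.rfl⟩
    | cons a l ih =>
      have h1 : distinct (a :: l) =
        if ∀ b ∈ distinct l, ¬ b = a then a :: distinct l else distinct l := rfl
      rw [h1]
      split_ifs with h
      · exact ⟨List.nodup_cons.2 ⟨fun ha => h a ha rfl, ih.1⟩, fun x => by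
          rw [List.mem_cons, List.mem_cons, ih.2]⟩
      · push Not at h
        obtain ⟨b, hb, rfl⟩ := h
        refine ⟨ih.1, fun x => ?_⟩
        rw [List.mem_cons, ← ih.2]
        exact ⟨Or.inr, fun hx => hx.elim (fun hx => hx ▸ hb) fun hx => hx⟩
  rw [← List.toFinset_card_of_nodup h.1]
  congr 1
  ext x
  simp [h.2]

end

/-! ### First fit -/

/-- Either `e` goes into a compartment that has room for it, while the suitable compartments in
front have not, or no suitable compartment has room for it and the default value is returned. -/
theorem place_spec {D : ℕ} {K : List Compartment} (A : List (Compartment × ℕ × ℕ × ℕ))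
    (e : ℕ × ℕ × ℕ) :
    (∃ l l', K = l ++ place D K A e :: l' ∧ Accepts D (place D K A e) e ∧
      used A (place D K A e) + e.2.2 ≤ (place D K A e).2.2 ∧
      ∀ κ ∈ l, Accepts D κ e → κ.2.2 < used A κ + e.2.2) ∨
    (place D K A e = (0, (0, 0), 0) ∧ ∀ κ ∈ K, Accepts D κ e → κ.2.2 < used A κ + e.2.2) := by
  have h0 : place D K A e = (K.find? fun κ => decide (Accepts D κ e ∧
      used A κ + e.2.2 ≤ κ.2.2)).getD (0, (0, 0), 0) := by
    rw [place, List.headD_eq_head?_getD, List.head?_filter]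
  cases h : K.find? fun κ => decide (Accepts D κ e ∧ used A κ + e.2.2 ≤ κ.2.2) with
  | none =>
    right
    rw [h] at h0
    refine ⟨h0, fun κ hκ ha => ?_⟩
    have := List.find?_eq_none.1 h κ hκ
    simp only [decide_eq_true_eq] at this
    by_contra hlt
    exact this ⟨ha, by omega⟩
  | some κ =>
    left
    rw [h, Option.getD_some] at h0
    rw [List.find?_eq_some_iff_append] at h
    obtain ⟨h1, l, l', h2, h3⟩ := h
    rw [decide_eq_true_eq] at h1
    rw [h0]
    refine ⟨l, l', h2, h1.1, h1.2, fun κ' hκ' ha => ?_⟩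
    have := h3 κ' hκ'
    simp only [Bool.not_eq_true', decide_eq_false_iff_not] at this
    by_contra hlt
    exact this ⟨ha, by omega⟩

theorem used_cons (κ₀ : Compartment) (e : ℕ × ℕ × ℕ) (A : List (Compartment × ℕ × ℕ × ℕ))
    (κ : Compartment) : used ((κ₀, e) :: A) κ = (if κ₀ = κ then e.2.2 else 0) + used A κ := by
  simp only [used, List.map_cons, List.sum_cons, Prod.ext_iff]

/-- First fit respects the capacities, and each item is too large for what is left in the end of
every suitable compartment in front of its own. -/
theorem firstFit_spec (D : ℕ) (K : List Compartment) (Y : List (ℕ × ℕ × ℕ)) :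
    (firstFit D K Y).map (fun x => x.2) = Y ∧
    (∀ κ ∈ K, κ.2.1.2 ≠ 0 → used (firstFit D K Y) κ ≤ κ.2.2) ∧
    ∀ x ∈ firstFit D K Y,
      (∃ l l', K = l ++ x.1 :: l' ∧ Accepts D x.1 x.2 ∧
        ∀ κ ∈ l, Accepts D κ x.2 → κ.2.2 < used (firstFit D K Y) κ + x.2.2.2) ∨
      (x.1 = (0, (0, 0), 0) ∧
        ∀ κ ∈ K, Accepts D κ x.2 → κ.2.2 < used (firstFit D K Y) κ + x.2.2.2) := by
  induction Y with
  | nil => exact ⟨rfl, fun κ _ _ => Nat.zero_le _, fun x hx => by simp [firstFit] at hx⟩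
  | cons e Y ih =>
    have h0 : firstFit D K (e :: Y) = (place D K (firstFit D K Y) e, e) :: firstFit D K Y := rfl
    rw [h0]
    generalize firstFit D K Y = A at ih ⊢
    obtain ⟨h1, h2, h3⟩ := ih
    have hp := place_spec (D := D) (K := K) A e
    generalize place D K A e = κ₀ at hp ⊢
    have hle : ∀ κ, used A κ ≤ used ((κ₀, e) :: A) κ := fun κ => by
      rw [used_cons]; exact Nat.le_add_left _ _
    refine ⟨by rw [List.map_cons, h1], fun κ hκ hu => ?_, fun x hx => ?_⟩
    · rw [used_cons]
      split_ifs with h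
      · subst h
        rcases hp with ⟨_, _, _, _, h4, _⟩ | ⟨h4, _⟩
        · omega
        · exact absurd (by rw [h4]) hu
      · rw [zero_add]; exact h2 κ hκ hu
    · have key : ∀ {l : List Compartment} {y : ℕ × ℕ × ℕ},
          (∀ κ ∈ l, Accepts D κ y → κ.2.2 < used A κ + y.2.2) →
          ∀ κ ∈ l, Accepts D κ y → κ.2.2 < used ((κ₀, e) :: A) κ + y.2.2 :=
        fun h κ hκ ha => (h κ hκ ha).trans_le (Nat.add_le_add_right (hle κ) _)
      rcases List.mem_cons.1 hx with rfl | hx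
      · rcases hp with ⟨l, l', h4, h5, _, h6⟩ | ⟨h4, h5⟩
        · exact Or.inl ⟨l, l', h4, h5, key h6⟩
        · exact Or.inr ⟨h4, key h5⟩
      · rcases h3 x hx with ⟨l, l', h4, h5, h6⟩ | ⟨h4, h5⟩
        · exact Or.inl ⟨l, l', h4, h5, key h6⟩
        · exact Or.inr ⟨h4, key h5⟩

/-- The assignment of first fit as a function of the positions of the items. -/
theorem firstFit_ofFn (D : ℕ) (K : List Compartment) {n : ℕ} (Y : Fin n → ℕ × ℕ × ℕ) :
    ∃ f : Fin n → Compartment, firstFit D K (List.ofFn Y) = List.ofFn (fun i => (f i, Y i)) ∧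
    (∀ κ ∈ K, κ.2.1.2 ≠ 0 → ∑ i with f i = κ, (Y i).2.2 ≤ κ.2.2) ∧
    ∀ i, (∃ l l', K = l ++ f i :: l' ∧ Accepts D (f i) (Y i) ∧
        ∀ κ ∈ l, Accepts D κ (Y i) → κ.2.2 < ∑ j with f j = κ, (Y j).2.2 + (Y i).2.2) ∨
      (f i = (0, (0, 0), 0) ∧
        ∀ κ ∈ K, Accepts D κ (Y i) → κ.2.2 < ∑ j with f j = κ, (Y j).2.2 + (Y i).2.2) := by
  obtain ⟨h1, h2, h3⟩ := firstFit_spec D K (List.ofFn Y)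
  generalize firstFit D K (List.ofFn Y) = A at h1 h2 h3 ⊢
  have hl : A.length = n := by simpa using congrArg List.length h1
  subst hl
  have hA : A = List.ofFn (fun i => ((A.get i).1, Y i)) := by
    conv_lhs => rw [← List.ofFn_get A]
    congr 1
    funext i
    have h4 : (A.map fun x => x.2)[(i : ℕ)]? = (List.ofFn Y)[(i : ℕ)]? := by rw [h1]
    simp at h4
    rw [← h4]
    rfl
  have hused : ∀ κ, used A κ = ∑ i with (A.get i).1 = κ, (Y i).2.2 := fun κ => by
    conv_lhs => rw [hA]
    rw [used, List.map_ofFn, List.sum_ofFn, Finset.sum_filter]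
    simp only [Function.comp_def, Prod.ext_iff]
  refine ⟨fun i => (A.get i).1, hA, fun κ hκ hu => hused κ ▸ h2 κ hκ hu, fun i => ?_⟩
  have hmem : ((A.get i).1, Y i) ∈ A :=
    (congrArg (((A.get i).1, Y i) ∈ ·) hA).mpr (List.mem_ofFn.2 ⟨i, rfl⟩)
  simpa only [hused] using h3 _ hmem

/-! ### Linear grouping -/

/-- The elements of `S` of every `g`-th rank form the thresholds `T`. Up to `g` exceptions, an
element has rank `r` with `r + g` still the rank of an element `φ i`, and a threshold lies between
the two. -/
theorem exists_grouping {n : ℕ} (S : Finset (Fin n)) (s : Fin n → ℕ) {g : ℕ} (hg : 0 < g) :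
    ∃ (T S' : Finset (Fin n)) (φ : Fin n → Fin n), T.card ≤ S.card / g + 1 ∧ T ⊆ S ∧ S' ⊆ S ∧
      (S \ S').card ≤ g ∧ (∀ i ∈ S', φ i ∈ S) ∧ (∀ i ∈ S', ∀ j ∈ S', φ i = φ j → i = j) ∧
      ∀ i ∈ S', ∃ t ∈ T, s i ≤ s t ∧ s t ≤ s (φ i) := by
  classical
  obtain ⟨k, hk⟩ : ∃ k, S.card = k := ⟨_, rfl⟩
  obtain ⟨E, hE, hES, hEm⟩ : ∃ E : Fin k → Fin n, Function.Injective E ∧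
      (∀ i, i ∈ S ↔ ∃ r, E r = i) ∧ Monotone fun r => s (E r) := by
    subst hk
    refine ⟨fun r => S.equivFin.symm (Tuple.sort (fun j => s (S.equivFin.symm j)) r), ?_, ?_, ?_⟩
    · intro a b h
      simpa using h
    · intro i
      refine ⟨fun hi => ⟨(Tuple.sort (fun j => s (S.equivFin.symm j))).symm (S.equivFin ⟨i, hi⟩),
        by simp⟩, ?_⟩
      rintro ⟨r, rfl⟩
      exact Subtype.property _
    · exact Tuple.monotone_sort (fun j => s (S.equivFin.symm j))
  rw [hk]
  have hφ : ∃ φ : Fin n → Fin n, ∀ (r : Fin k) (h : (r : ℕ) + g < k),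
      φ (E r) = E ⟨r + g, h⟩ := by
    refine ⟨fun i => if h : ∃ r : Fin k, E r = i ∧ (r : ℕ) + g < k then
      E ⟨h.choose + g, h.choose_spec.2⟩ else i, fun r h => ?_⟩
    have h1 : ∃ r' : Fin k, E r' = E r ∧ (r' : ℕ) + g < k := ⟨r, rfl, h⟩
    have h2 : h1.choose = r := hE h1.choose_spec.1
    simp only [dif_pos h1, h2]
  obtain ⟨φ, hφ⟩ := hφ
  refine ⟨(Finset.univ.filter fun r : Fin k => g ∣ r).image E,
    (Finset.univ.filter fun r : Fin k => (r : ℕ) + g < k).image E, φ, ?_, ?_, ?_, ?_, ?_, ?_, ?_⟩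
  · refine Finset.card_image_le.trans ?_
    rw [← Finset.card_range (k / g + 1)]
    refine Finset.card_le_card_of_injOn (fun r => (r : ℕ) / g) (fun r _ => ?_) ?_
    · have := Nat.div_le_div_right (c := g) r.2.le
      simp only [Finset.coe_range, Set.mem_Iio]; omega
    · intro a ha b hb hab
      simp only [Finset.coe_filter, Finset.mem_univ, true_and, Set.mem_ofPred_eq] at ha hb
      exact Fin.ext (Nat.div_left_inj ha hb |>.1 hab)
  · intro i hi
    obtain ⟨r, -, rfl⟩ := Finset.mem_image.1 hi
    exact (hES _).2 ⟨r, rfl⟩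
  · intro i hi
    obtain ⟨r, -, rfl⟩ := Finset.mem_image.1 hi
    exact (hES _).2 ⟨r, rfl⟩
  · have h1 : S \ (Finset.univ.filter fun r : Fin k => (r : ℕ) + g < k).image E ⊆
        (Finset.univ.filter fun r : Fin k => k ≤ (r : ℕ) + g).image E := by
      intro i hi
      rw [Finset.mem_sdiff, hES] at hi
      obtain ⟨⟨r, rfl⟩, h⟩ := hi
      refine Finset.mem_image_of_mem E (Finset.mem_filter.2 ⟨Finset.mem_univ _, ?_⟩)
      by_contra hlt
      exact h (Finset.mem_image_of_mem E (Finset.mem_filter.2 ⟨Finset.mem_univ _, by omega⟩))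
    refine (Finset.card_le_card h1).trans (Finset.card_image_le.trans ?_)
    conv_rhs => rw [← Finset.card_range g]
    refine Finset.card_le_card_of_injOn (fun r => k - 1 - (r : ℕ)) (fun r hr => ?_) ?_
    · simp only [Finset.coe_filter, Finset.mem_univ, true_and, Set.mem_ofPred_eq] at hr
      simp only [Finset.coe_range, Set.mem_Iio]
      have := r.2
      omega
    · intro a _ b _ hab
      have := a.2
      have := b.2
      simp only at hab
      exact Fin.ext (by omega)
  · intro i hi
    obtain ⟨r, hr, rfl⟩ := Finset.mem_image.1 hi
    rw [hφ r (Finset.mem_filter.1 hr).2]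
    exact (hES _).2 ⟨_, rfl⟩
  · intro i hi j hj hij
    obtain ⟨r, hr, rfl⟩ := Finset.mem_image.1 hi
    obtain ⟨r', hr', rfl⟩ := Finset.mem_image.1 hj
    rw [hφ r (Finset.mem_filter.1 hr).2, hφ r' (Finset.mem_filter.1 hr').2] at hij
    have := congrArg Fin.val (hE hij)
    simp only [add_left_inj] at this
    rw [Fin.ext this]
  · intro i hi
    obtain ⟨r, hr, rfl⟩ := Finset.mem_image.1 hi
    have hr' := (Finset.mem_filter.1 hr).2
    -- The threshold is the one with the least rank that is not smaller than `r`.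
    have h1 : (r : ℕ) ≤ (r + (g - 1)) / g * g := by
      have h1 := Nat.div_add_mod (r + (g - 1)) g
      have h2 := Nat.mod_lt (r + (g - 1)) hg
      rw [mul_comm] at h1
      omega
    have h2 : (r + (g - 1)) / g * g ≤ r + (g - 1) := Nat.div_mul_le_self _ _
    have h3 : (r + (g - 1)) / g * g < k := by omega
    refine ⟨E ⟨_, h3⟩, Finset.mem_image_of_mem E (Finset.mem_filter.2 ⟨Finset.mem_univ _,
      Nat.dvd_mul_left _ _⟩), ?_, ?_⟩
    · exact hEm (Fin.le_def.2 h1)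
    · rw [hφ r hr']
      exact hEm (Fin.le_def.2 (h2.trans (by simp)))

/-! ### Reserved slots -/

theorem unit_le {D : ℕ} {R : List (ℕ × ℕ)} {e r : ℕ × ℕ} (hr : r ∈ R) (h : r.1 = e.1)
    (h' : e.2 ≤ r.2) : unit D R e ≤ r.2 := by
  have hr' : r ∈ R.filter fun r => r.1 = e.1 ∧ e.2 ≤ r.2 :=
    List.mem_filter.2 ⟨hr, by simp [h, h']⟩
  unfold unit
  generalize R.filter (fun r => decide (r.1 = e.1 ∧ e.2 ≤ r.2)) = l at hr' ⊢
  induction l with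
  | nil => simp at hr'
  | cons a l ih =>
    rw [List.foldr_cons]
    rcases List.mem_cons.1 hr' with rfl | h
    · exact min_le_left _ _
    · exact (min_le_right _ _).trans (ih h)

theorem unit_eq (D : ℕ) (R : List (ℕ × ℕ)) (e : ℕ × ℕ) :
    unit D R e = D + 1 ∨ (e.1, unit D R e) ∈ R ∧ e.2 ≤ unit D R e := by
  have h : ∀ l : List (ℕ × ℕ), (∀ r ∈ l, r ∈ R ∧ r.1 = e.1 ∧ e.2 ≤ r.2) →
      l.foldr (fun r u => min r.2 u) (D + 1) = D + 1 ∨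
      (e.1, l.foldr (fun r u => min r.2 u) (D + 1)) ∈ R ∧
        e.2 ≤ l.foldr (fun r u => min r.2 u) (D + 1) := by
    intro l
    induction l with
    | nil => intro _; exact Or.inl rfl
    | cons a l ih =>
      intro hl
      rw [List.foldr_cons]
      obtain ⟨h1, h2, h3⟩ := hl a List.mem_cons_self
      rcases min_choice a.2 (l.foldr (fun r u => min r.2 u) (D + 1)) with h | h
      · rw [h, ← h2]
        exact Or.inr ⟨h1, h3⟩
      · rw [h]
        exact ih fun r hr => hl r (List.mem_cons_of_mem _ hr)
  refine h _ fun r hr => ?_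
  rw [List.mem_filter, decide_eq_true_eq] at hr
  exact hr

/-- References `R` and numbers of slots that are adapted to a packing `P` of items with colours
`col` and sizes `s` into bins of capacity `L * w`. An item is small if its size is at most `w`. The
bin `b` reserves the space `slots b r * r.2` for the items with reference `r`; for a large size
`r.2` this is the room for `slots b r` items. The number `u i` is the size of the reference of the
item `i`. -/
structure Slotting {n : ℕ} (m L w : ℕ) (col s P : Fin n → ℕ) (R : Finset (ℕ × ℕ))
    (slots : ℕ → ℕ × ℕ → ℕ) (u : Fin n → ℕ) : Prop where
  u_eq : ∀ i, u i = unit (L * w) R.toList (col i, s i)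
  card_le : R.card ≤ m * (L ^ 2 + 2)
  mem_pool : ∀ r ∈ R, (r.1 < m ∧ r.2 = w) ∨ ∃ i, r = (col i, s i)
  le_ref : ∀ r ∈ R, w ≤ r.2
  ref_le : ∀ r ∈ R, r.2 ≤ L * w
  le_u : ∀ i, s i ≤ u i
  u_eq_iff : ∀ i, u i = w ↔ s i ≤ w
  ref_mem : ∀ i, u i ≤ L * w → (col i, u i) ∈ R
  sum_le : ∀ b, ∑ r ∈ R, slots b r * r.2 ≤ L * w
  exists_of_ne : ∀ b r, slots b r ≠ 0 → ∃ i, P i = b ∧ col i = r.1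
  eq_zero : ∀ b r, r ∉ R → slots b r = 0
  small_lt : ∀ b c, ∑ i with P i = b ∧ col i = c ∧ s i ≤ w, s i < (slots b (c, w) + 1) * w
  large_le : ∀ c, ∃ X : Finset (Fin n),
    X.card ≤ (Finset.univ.filter fun i => col i = c ∧ w < s i).card / L ^ 2 + 1 ∧
    ∀ v, v ≠ w → (Finset.univ.filter fun i => col i = c ∧ u i = v).card ≤
      ∑ b ∈ Finset.univ.image P, slots b (c, v) + (X.filter fun i => u i = v).card

theorem exists_slotting {n m L w : ℕ} {col s P : Fin n → ℕ} (hL : 0 < L) (hw : 0 < w)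
    (hcol : ∀ i, col i < m) (hP : ∀ b, ∑ i with P i = b, s i ≤ L * w) :
    ∃ R slots u, Slotting m L w col s P R slots u := by
  classical
  have hsD : ∀ i, s i ≤ L * w := fun i =>
    le_trans (Finset.single_le_sum (f := s) (s := Finset.univ.filter fun j => P j = P i)
      (fun _ _ => Nat.zero_le _) (Finset.mem_filter.2 ⟨Finset.mem_univ i, rfl⟩)) (hP (P i))
  have hwD : w ≤ L * w := Nat.le_mul_of_pos_left w hL
  choose T S' φ hT1 hT2 hS1 hS2 hφ1 hφ2 hφ3 using fun c : ℕ =>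
    exists_grouping (Finset.univ.filter fun i => col i = c ∧ w < s i) s
      (g := (Finset.univ.filter fun i => col i = c ∧ w < s i).card / L ^ 2 + 1) (Nat.succ_pos _)
  have hT3 : ∀ c, (T c).card ≤ L ^ 2 + 1 := fun c => by
    refine (hT1 c).trans (Nat.add_le_add_right (Nat.div_le_of_le_mul ?_) 1)
    have := Nat.div_add_mod (Finset.univ.filter fun i => col i = c ∧ w < s i).card (L ^ 2)
    have := Nat.mod_lt (Finset.univ.filter fun i => col i = c ∧ w < s i).card
      (show 0 < L ^ 2 by positivity)
    rw [add_mul, one_mul, mul_comm (_ / _)]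
    omega
  obtain ⟨R, hR⟩ : ∃ R : Finset (ℕ × ℕ), R = (Finset.range m).image (fun c => (c, w)) ∪
    (Finset.range m).biUnion fun c => (T c).image fun t => (c, s t) := ⟨_, rfl⟩
  have hmem : ∀ r, r ∈ R ↔ (r.1 < m ∧ r.2 = w) ∨ (r.1 < m ∧ ∃ t ∈ T r.1, s t = r.2) := by
    rintro ⟨c, v⟩
    simp only [hR, Finset.mem_union, Finset.mem_image, Finset.mem_range, Prod.mk.injEq,
      Finset.mem_biUnion]
    constructor
    · rintro (⟨a, h, rfl, rfl⟩ | ⟨a, h, t, ht, rfl, rfl⟩)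
      · exact Or.inl ⟨h, rfl⟩
      · exact Or.inr ⟨h, t, ht, rfl⟩
    · rintro (⟨h, h'⟩ | ⟨h, t, ht, h'⟩)
      · exact Or.inl ⟨c, h, rfl, h'.symm⟩
      · exact Or.inr ⟨c, h, t, ht, rfl, h'⟩
  have hT4 : ∀ c, ∀ t ∈ T c, col t = c ∧ w < s t := fun c t ht => by
    simpa using hT2 c ht
  have hS3 : ∀ c, ∀ i ∈ S' c, col i = c ∧ w < s i := fun c t ht => by
    simpa using hS1 c ht
  have hφ4 : ∀ c, ∀ i ∈ S' c, col (φ c i) = c ∧ w < s (φ c i) := fun c i hi => by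
    simpa using hφ1 c i hi
  have hRw : ∀ r ∈ R, w ≤ r.2 := fun r hr => by
    rcases (hmem r).1 hr with ⟨_, h⟩ | ⟨_, t, ht, h⟩
    · exact h.ge
    · exact h ▸ (hT4 _ _ ht).2.le
  obtain ⟨u, hu⟩ : ∃ u : Fin n → ℕ, ∀ i, u i = unit (L * w) R.toList (col i, s i) :=
    ⟨_, fun _ => rfl⟩
  have hsu : ∀ i, s i ≤ u i := fun i => by
    rcases unit_eq (L * w) R.toList (col i, s i) with h | ⟨_, h⟩
    · rw [hu, h]; exact (hsD i).trans (Nat.le_succ _)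
    · rw [hu]; exact h
  have hwR : ∀ i, (col i, w) ∈ R := fun i => (hmem _).2 (Or.inl ⟨hcol i, rfl⟩)
  have hkey : ∀ i, u i ≤ L * w → (col i, u i) ∈ R := fun i hi => by
    rcases unit_eq (L * w) R.toList (col i, s i) with h | ⟨h, _⟩
    · rw [hu, h] at hi; omega
    · rw [hu]; exact Finset.mem_toList.1 h
  have huw : ∀ i, u i = w ↔ s i ≤ w := fun i => by
    refine ⟨fun h => h ▸ hsu i, fun h => ?_⟩
    have h1 : u i ≤ w := by
      rw [hu]
      exact unit_le (r := (col i, w)) (Finset.mem_toList.2 (hwR i)) rfl h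
    exact le_antisymm h1 (hRw _ (hkey i (h1.trans hwD)))
  -- The items that are not exceptional in the grouping of their colour.
  obtain ⟨G, hG⟩ : ∃ G : Finset (Fin n), G = Finset.univ.filter fun i => i ∈ S' (col i) := ⟨_, rfl⟩
  obtain ⟨ψ, hψ⟩ : ∃ ψ : Fin n → Fin n, ∀ i, ψ i = φ (col i) i := ⟨_, fun _ => rfl⟩
  have hG1 : ∀ i, i ∈ G ↔ i ∈ S' (col i) := fun i => by simp [hG]
  have hGu : ∀ i ∈ G, u i ≤ s (ψ i) := fun i hi => by
    obtain ⟨t, ht, h1, h2⟩ := hφ3 (col i) i ((hG1 i).1 hi)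
    rw [hu, hψ]
    refine (unit_le (r := (col i, s t)) (e := (col i, s i))
      (Finset.mem_toList.2 ((hmem _).2 (Or.inr ⟨hcol i, t, ht, rfl⟩))) rfl h1).trans h2
  have hGl : ∀ i ∈ G, w < s i := fun i hi => (hS3 _ _ ((hG1 i).1 hi)).2
  have hGR : ∀ i ∈ G, (col i, u i) ∈ R := fun i hi => hkey i ((hGu i hi).trans (hsD _))
  have hψinj : Set.InjOn ψ G := by
    intro i hi j hj hij
    rw [Finset.mem_coe, hG1] at hi hj
    rw [hψ, hψ] at hij
    have h1 := (hφ4 _ _ hi).1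
    have h2 := (hφ4 _ _ hj).1
    have h3 : col i = col j := by rw [← h1, hij, h2]
    rw [← h3] at hj hij
    exact hφ2 _ i hi j hj hij
  obtain ⟨slots, hslots⟩ : ∃ slots : ℕ → ℕ × ℕ → ℕ, ∀ b r, slots b r = if r.2 = w then
      (∑ i with P i = b ∧ (col i, u i) = r, s i) / w
    else (G.filter fun i => P (ψ i) = b ∧ (col i, u i) = r).card := ⟨_, fun _ _ => rfl⟩
  refine ⟨R, slots, u, hu, ?_, ?_, hRw, ?_, hsu, huw, hkey, ?_, ?_, ?_, ?_, ?_⟩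
  · rw [hR]
    refine (Finset.card_union_le _ _).trans ?_
    have h1 : ((Finset.range m).image (fun c => (c, w))).card ≤ m :=
      Finset.card_image_le.trans (Finset.card_range m).le
    have h2 := Finset.card_biUnion_le_card_mul (Finset.range m)
      (fun c => (T c).image fun t => (c, s t)) (L ^ 2 + 1)
      (fun c _ => Finset.card_image_le.trans (hT3 c))
    rw [Finset.card_range] at h2
    calc _ ≤ m + m * (L ^ 2 + 1) := Nat.add_le_add h1 h2
      _ = _ := by ring
  · rintro ⟨c, v⟩ hr
    rcases (hmem _).1 hr with h | ⟨_, t, ht, h⟩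
    · exact Or.inl h
    · exact Or.inr ⟨t, by rw [(hT4 _ _ ht).1, h]⟩
  · intro r hr
    rcases (hmem r).1 hr with ⟨_, h⟩ | ⟨_, t, ht, h⟩
    · exact h ▸ hwD
    · exact h ▸ hsD t
  · intro b
    have h1 : ∀ r ∈ R, slots b r * r.2 ≤
        ∑ i ∈ Finset.univ.filter (fun i => P i = b ∧ s i ≤ w) with (col i, u i) = r, s i +
        ∑ i ∈ G.filter (fun i => P (ψ i) = b) with (col i, u i) = r, s (ψ i) := by
      intro r _
      rw [hslots, Finset.filter_filter, Finset.filter_filter]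
      split_ifs with h
      · rw [h]
        refine (Nat.div_mul_le_self _ _).trans (le_trans ?_ (Nat.le_add_right _ _))
        refine Finset.sum_le_sum_of_subset fun i hi => ?_
        simp only [Finset.mem_filter, Finset.mem_univ, true_and] at hi ⊢
        refine ⟨⟨hi.1, (huw i).1 ?_⟩, hi.2⟩
        rw [← h, ← hi.2]
      · refine le_trans ?_ (Nat.le_add_left _ _)
        rw [← smul_eq_mul]
        refine Finset.card_nsmul_le_sum _ _ _ fun i hi => ?_
        rw [Finset.mem_filter] at hi
        rw [← hi.2.2]
        exact hGu i hi.1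
    refine (Finset.sum_le_sum h1).trans ?_
    rw [Finset.sum_add_distrib, Finset.sum_fiberwise_of_maps_to, Finset.sum_fiberwise_of_maps_to,
      ← Finset.sum_image (f := s) (g := ψ) (s := G.filter fun i => P (ψ i) = b)]
    · refine le_trans ?_ (hP b)
      rw [← Finset.sum_union]
      · refine Finset.sum_le_sum_of_subset fun i hi => ?_
        rw [Finset.mem_union, Finset.mem_image, Finset.mem_filter] at hi
        rcases hi with ⟨_, h, _⟩ | ⟨j, hj, rfl⟩
        · exact Finset.mem_filter.2 ⟨Finset.mem_univ _, h⟩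
        · exact Finset.mem_filter.2 ⟨Finset.mem_univ _, (Finset.mem_filter.1 hj).2⟩
      · rw [Finset.disjoint_left]
        intro i hi hi'
        obtain ⟨j, hj, rfl⟩ := Finset.mem_image.1 hi'
        have h2 := (hφ4 _ _ ((hG1 j).1 (Finset.mem_filter.1 hj).1)).2
        rw [← hψ] at h2
        have := (Finset.mem_filter.1 hi).2.2
        omega
    · exact hψinj.mono fun i hi => (Finset.mem_filter.1 hi).1
    · exact fun i hi => hGR i (Finset.mem_filter.1 hi).1
    · exact fun i hi => (huw i).2 (Finset.mem_filter.1 hi).2.2 ▸ hwR i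
  · intro b r h
    rw [hslots] at h
    split_ifs at h with hr
    · obtain ⟨i, hi, -⟩ := Finset.exists_ne_zero_of_sum_ne_zero
        (show ∑ i with P i = b ∧ (col i, u i) = r, s i ≠ 0 from fun h0 => h (by rw [h0]; simp))
      rw [Finset.mem_filter] at hi
      exact ⟨i, hi.2.1, by rw [← hi.2.2]⟩
    · obtain ⟨i, hi⟩ := Finset.card_ne_zero.1 h
      rw [Finset.mem_filter] at hi
      refine ⟨ψ i, hi.2.1, ?_⟩
      rw [hψ, (hφ4 _ _ ((hG1 i).1 hi.1)).1, ← hi.2.2]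
  · intro b r hr
    rw [hslots]
    split_ifs with h
    · rw [Finset.filter_false_of_mem, Finset.sum_empty, Nat.zero_div]
      rintro i - ⟨-, rfl⟩
      exact hr (hkey i (le_of_eq_of_le h hwD))
    · rw [Finset.card_eq_zero]
      refine Finset.filter_false_of_mem ?_
      rintro i hi ⟨-, rfl⟩
      exact hr (hGR i hi)
  · intro b c
    rw [hslots, if_pos rfl]
    have h1 : (Finset.univ.filter fun i => P i = b ∧ (col i, u i) = (c, w)) =
        Finset.univ.filter fun i => P i = b ∧ col i = c ∧ s i ≤ w := by
      ext i
      simp [huw]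
    rw [h1]
    have h2 := Nat.div_add_mod (∑ i with P i = b ∧ col i = c ∧ s i ≤ w, s i) w
    have h3 := Nat.mod_lt (∑ i with P i = b ∧ col i = c ∧ s i ≤ w, s i) hw
    rw [add_mul, one_mul, mul_comm (_ / _)]
    omega
  · intro c
    refine ⟨_, hS2 c, fun v hv => ?_⟩
    have h1 : ∀ b, slots b (c, v) = (G.filter fun i => P (ψ i) = b ∧ (col i, u i) = (c, v)).card :=
      fun b => by rw [hslots, if_neg hv]
    simp only [h1]
    have h2 : (G.filter fun i => (col i, u i) = (c, v)).card =
        ∑ b ∈ Finset.univ.image P, (G.filter fun i => P (ψ i) = b ∧ (col i, u i) = (c, v)).card := by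
      rw [Finset.card_eq_sum_card_fiberwise (f := fun i => P (ψ i)) (t := Finset.univ.image P)]
      · refine Finset.sum_congr rfl fun b _ => ?_
        rw [Finset.filter_filter]
        simp only [and_comm]
      · intro i _
        exact Finset.mem_coe.2 (Finset.mem_image_of_mem P (Finset.mem_univ _))
    rw [← h2]
    refine le_trans (Finset.card_le_card ?_) (Finset.card_union_le _ _)
    intro i hi
    simp only [Finset.mem_filter, Finset.mem_univ, true_and, Finset.mem_union, Finset.mem_sdiff,
      Prod.mk.injEq] at hi ⊢
    by_cases h : i ∈ G
    · exact Or.inl ⟨h, hi⟩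
    · rw [hG1, hi.1] at h
      have := (huw i).not.1 (hi.2 ▸ hv)
      exact Or.inr ⟨⟨⟨hi.1, by omega⟩, h⟩, hi.2⟩

/-! ### The overflow of first fit -/

/-- The bins that contain an item of colour `c`. -/
def spanned {n : ℕ} (col P : Fin n → ℕ) (c : ℕ) : Finset ℕ :=
  (Finset.univ.filter fun i => col i = c).image P

theorem card_spanned_le {n : ℕ} (col P : Fin n → ℕ) (c : ℕ) :
    (spanned col P c).card ≤ (Finset.univ.image P).card :=
  Finset.card_le_card (Finset.image_subset_image (Finset.filter_subset _ _))

theorem sum_colour_le {n D : ℕ} {col s P : Fin n → ℕ} (hP : ∀ b, ∑ i with P i = b, s i ≤ D)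
    (c : ℕ) : ∑ i with col i = c, s i ≤ (spanned col P c).card * D := by
  rw [← Finset.sum_fiberwise_of_maps_to (g := P) (t := spanned col P c)
    (fun i hi => Finset.mem_image_of_mem P hi), ← smul_eq_mul]
  refine Finset.sum_le_card_nsmul _ _ _ fun b _ => ?_
  refine le_trans (Finset.sum_le_sum_of_subset fun i hi => ?_) (hP b)
  exact Finset.mem_filter.2 ⟨Finset.mem_univ i, (Finset.mem_filter.1 hi).2⟩

namespace Slotting

variable {n m L w : ℕ} {col s P : Fin n → ℕ} {R : Finset (ℕ × ℕ)} {slots : ℕ → ℕ × ℕ → ℕ}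
  {u : Fin n → ℕ}

theorem slots_le (h : Slotting m L w col s P R slots u) (hw : 0 < w) (b : ℕ) {r : ℕ × ℕ}
    (hr : r ∈ R) : slots b r ≤ L := by
  have h1 := (Finset.single_le_sum (f := fun r => slots b r * r.2) (fun _ _ => Nat.zero_le _)
    hr).trans (h.sum_le b)
  exact Nat.le_of_mul_le_mul_right ((Nat.mul_le_mul_left _ (h.le_ref r hr)).trans h1) hw

/-- If a small item of colour `c` overflows, then the space that is reserved for such items is used
up to at most `w` in each bin; so the overflow is at most `2 * w` for each bin of `P` with items of
colour `c`. -/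
theorem small_overflow_le (h : Slotting m L w col s P R slots u) (hL : 0 < L)
    (O : Finset (Fin n)) (U : ℕ → ℕ × ℕ → Finset (Fin n))
    (hU : ∀ b r, ∀ i ∈ U b r, i ∉ O ∧ (col i, u i) = r)
    (hdisj : ∀ r b b', b ∈ Finset.univ.image P → b' ∈ Finset.univ.image P → b ≠ b' →
      Disjoint (U b r) (U b' r))
    (hO : ∀ i ∈ O, ∀ b ∈ Finset.univ.image P, (col i, u i) ∈ R →
      slots b (col i, u i) * u i < ∑ j ∈ U b (col i, u i), s j + s i) (c : ℕ) :
    ∑ i ∈ O with col i = c ∧ s i ≤ w, s i ≤ (spanned col P c).card * (2 * w) := by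
  classical
  rcases Finset.eq_empty_or_nonempty (O.filter fun i => col i = c ∧ s i ≤ w) with h0 | ⟨i₀, hi₀⟩
  · rw [h0]; exact Nat.zero_le _
  obtain ⟨h1, hc, h2⟩ := Finset.mem_filter.1 hi₀
  have hu0 : u i₀ = w := (h.u_eq_iff i₀).2 h2
  have hcR : (c, w) ∈ R := by
    have := h.ref_mem i₀ (hu0.le.trans (Nat.le_mul_of_pos_left w hL))
    rwa [hu0, hc] at this
  have hsub : spanned col P c ⊆ Finset.univ.image P :=
    Finset.image_subset_image (Finset.filter_subset _ _)
  have h3 : ∀ b ∈ spanned col P c,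
      ∑ i ∈ Finset.univ.filter (fun i => col i = c ∧ s i ≤ w) with P i = b, s i ≤
        ∑ j ∈ U b (c, w), s j + 2 * w := by
    intro b hb
    have h4 := hO i₀ h1 b (hsub hb)
    rw [hu0, hc] at h4
    have h5 := h4 hcR
    have h6 := h.small_lt b c
    rw [Finset.filter_filter]
    rw [add_mul, one_mul] at h6
    simp only [and_comm] at h6 ⊢
    omega
  have h4 : ∑ i with col i = c ∧ s i ≤ w, s i ≤
      ∑ b ∈ spanned col P c, ∑ j ∈ U b (c, w), s j + (spanned col P c).card * (2 * w) := by
    rw [← smul_eq_mul, ← Finset.sum_const, ← Finset.sum_add_distrib,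
      ← Finset.sum_fiberwise_of_maps_to (g := P) (t := spanned col P c)]
    · exact Finset.sum_le_sum h3
    · intro i hi
      refine Finset.mem_image_of_mem P (Finset.mem_filter.2 ⟨Finset.mem_univ _, ?_⟩)
      exact (Finset.mem_filter.1 hi).2.1
  have h5 : ∑ i ∈ O with col i = c ∧ s i ≤ w, s i + ∑ b ∈ spanned col P c, ∑ j ∈ U b (c, w), s j ≤
      ∑ i with col i = c ∧ s i ≤ w, s i := by
    rw [← Finset.sum_biUnion fun b hb b' hb' hbb => hdisj _ b b' (hsub hb) (hsub hb') hbb,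
      ← Finset.sum_union]
    · refine Finset.sum_le_sum_of_subset fun i hi => ?_
      rcases Finset.mem_union.1 hi with hi | hi
      · exact Finset.mem_filter.2 ⟨Finset.mem_univ _, (Finset.mem_filter.1 hi).2⟩
      · obtain ⟨b, -, hb⟩ := Finset.mem_biUnion.1 hi
        have h6 := (hU _ _ i hb).2
        rw [Prod.mk.injEq] at h6
        exact Finset.mem_filter.2 ⟨Finset.mem_univ _, h6.1, (h.u_eq_iff i).1 h6.2⟩
    · rw [Finset.disjoint_left]
      intro i hi hi'
      obtain ⟨b, -, hb⟩ := Finset.mem_biUnion.1 hi'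
      exact (hU _ _ i hb).1 (Finset.mem_filter.1 hi).1
  omega

/-- If a large item overflows, then all the slots for its reference are taken; so only as many items
overflow as are exceptional in the grouping. -/
theorem large_overflow_le (h : Slotting m L w col s P R slots u)
    (O : Finset (Fin n)) (U : ℕ → ℕ × ℕ → Finset (Fin n))
    (hU : ∀ b r, ∀ i ∈ U b r, i ∉ O ∧ (col i, u i) = r)
    (hdisj : ∀ r b b', b ∈ Finset.univ.image P → b' ∈ Finset.univ.image P → b ≠ b' →
      Disjoint (U b r) (U b' r))
    (hO : ∀ i ∈ O, ∀ b ∈ Finset.univ.image P, (col i, u i) ∈ R →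
      slots b (col i, u i) * u i < ∑ j ∈ U b (col i, u i), s j + s i) (c : ℕ) :
    (O.filter fun i => col i = c ∧ w < s i).card ≤
      (Finset.univ.filter fun i => col i = c ∧ w < s i).card / L ^ 2 + 1 := by
  classical
  obtain ⟨X, hX, hX'⟩ := h.large_le c
  refine le_trans ?_ hX
  rw [Finset.card_eq_sum_card_fiberwise (f := u) (t := Finset.univ.image u)
    fun i _ => Finset.mem_coe.2 (Finset.mem_image_of_mem u (Finset.mem_univ i)),
    Finset.card_eq_sum_card_fiberwise (s := X) (f := u) (t := Finset.univ.image u)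
    fun i _ => Finset.mem_coe.2 (Finset.mem_image_of_mem u (Finset.mem_univ i))]
  refine Finset.sum_le_sum fun v _ => ?_
  rcases Finset.eq_empty_or_nonempty ((O.filter fun i => col i = c ∧ w < s i).filter
    fun i => u i = v) with h0 | ⟨i₀, hi₀⟩
  · rw [h0]; exact Nat.zero_le _
  obtain ⟨h2, rfl⟩ := Finset.mem_filter.1 hi₀
  obtain ⟨h1, rfl, h2⟩ := Finset.mem_filter.1 h2
  have hv : u i₀ ≠ w := fun h3 => by
    have := (h.u_eq_iff i₀).1 h3; omega
  have h3 := hX' _ hv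
  have h4 : ∀ b ∈ Finset.univ.image P, slots b (col i₀, u i₀) ≤ (U b (col i₀, u i₀)).card := by
    intro b hb
    by_cases hR : (col i₀, u i₀) ∈ R
    · have h5 := hO i₀ h1 b hb hR
      have h6 : ∑ j ∈ U b (col i₀, u i₀), s j ≤ (U b (col i₀, u i₀)).card * u i₀ := by
        rw [← smul_eq_mul]
        refine Finset.sum_le_card_nsmul _ _ _ fun j hj => ?_
        have h7 := (hU _ _ j hj).2
        rw [Prod.mk.injEq] at h7
        exact h7.2 ▸ h.le_u j
      have h7 := h.le_u i₀
      have h8 : slots b (col i₀, u i₀) * u i₀ < ((U b (col i₀, u i₀)).card + 1) * u i₀ := by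
        rw [add_mul, one_mul]; omega
      exact Nat.lt_succ_iff.1 (lt_of_mul_lt_mul_right h8 (Nat.zero_le _))
    · rw [h.eq_zero b _ hR]; exact Nat.zero_le _
  have h5 : ((O.filter fun i => col i = col i₀ ∧ w < s i).filter fun i => u i = u i₀).card +
      ∑ b ∈ Finset.univ.image P, (U b (col i₀, u i₀)).card ≤
      (Finset.univ.filter fun i => col i = col i₀ ∧ u i = u i₀).card := by
    rw [← Finset.card_biUnion fun b hb b' hb' hbb => hdisj _ b b' hb hb' hbb,
      ← Finset.card_union_of_disjoint]
    · refine Finset.card_le_card fun i hi => ?_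
      rcases Finset.mem_union.1 hi with hi | hi
      · obtain ⟨hi1, hi2⟩ := Finset.mem_filter.1 hi
        exact Finset.mem_filter.2 ⟨Finset.mem_univ _, (Finset.mem_filter.1 hi1).2.1, hi2⟩
      · obtain ⟨b, -, hb⟩ := Finset.mem_biUnion.1 hi
        have h6 := (hU _ _ i hb).2
        rw [Prod.mk.injEq] at h6
        exact Finset.mem_filter.2 ⟨Finset.mem_univ _, h6⟩
    · rw [Finset.disjoint_left]
      intro i hi hi'
      obtain ⟨b, -, hb⟩ := Finset.mem_biUnion.1 hi'
      exact (hU _ _ i hb).1 (Finset.mem_filter.1 (Finset.mem_filter.1 hi).1).1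
  have h6 := Finset.sum_le_sum h4
  omega

theorem overflow_le (h : Slotting m L w col s P R slots u) (hL : 0 < L) (hw : 0 < w)
    (hP : ∀ b, ∑ i with P i = b, s i ≤ L * w)
    (O : Finset (Fin n)) (U : ℕ → ℕ × ℕ → Finset (Fin n))
    (hU : ∀ b r, ∀ i ∈ U b r, i ∉ O ∧ (col i, u i) = r)
    (hdisj : ∀ r b b', b ∈ Finset.univ.image P → b' ∈ Finset.univ.image P → b ≠ b' →
      Disjoint (U b r) (U b' r))
    (hO : ∀ i ∈ O, ∀ b ∈ Finset.univ.image P, (col i, u i) ∈ R →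
      slots b (col i, u i) * u i < ∑ j ∈ U b (col i, u i), s j + s i) (c : ℕ) :
    ∑ i ∈ O with col i = c, s i ≤ (3 * (spanned col P c).card + L) * w := by
  classical
  have h1 := h.small_overflow_le hL O U hU hdisj hO c
  have h2 := h.large_overflow_le O U hU hdisj hO c
  have hsD : ∀ i, s i ≤ L * w := fun i =>
    le_trans (Finset.single_le_sum (f := s) (s := Finset.univ.filter fun j => P j = P i)
      (fun _ _ => Nat.zero_le _) (Finset.mem_filter.2 ⟨Finset.mem_univ i, rfl⟩)) (hP (P i))
  -- Every large item takes the space `w`.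
  have h3 : (Finset.univ.filter fun i => col i = c ∧ w < s i).card ≤
      (spanned col P c).card * L := by
    refine Nat.le_of_mul_le_mul_right (c := w) ?_ hw
    rw [mul_assoc]
    refine le_trans ?_ (sum_colour_le hP c)
    rw [← smul_eq_mul]
    refine (Finset.card_nsmul_le_sum _ s _ fun i hi => (Finset.mem_filter.1 hi).2.2.le).trans ?_
    exact Finset.sum_le_sum_of_subset fun i hi =>
      Finset.mem_filter.2 ⟨Finset.mem_univ _, (Finset.mem_filter.1 hi).2.1⟩
  have h4 : ((Finset.univ.filter fun i => col i = c ∧ w < s i).card / L ^ 2 + 1) * L ≤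
      (spanned col P c).card + L := by
    rw [add_mul, one_mul, pow_two, ← Nat.div_div_eq_div_mul]
    refine Nat.add_le_add_right ((Nat.div_mul_le_self _ _).trans ?_) _
    exact Nat.div_le_of_le_mul (mul_comm L _ ▸ h3)
  have h5 : ∑ i ∈ O with col i = c ∧ w < s i, s i ≤
      (O.filter fun i => col i = c ∧ w < s i).card * (L * w) := by
    rw [← smul_eq_mul]
    exact Finset.sum_le_card_nsmul _ _ _ fun i _ => hsD i
  have h6 : ∑ i ∈ O with col i = c, s i = ∑ i ∈ O with col i = c ∧ s i ≤ w, s i +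
      ∑ i ∈ O with col i = c ∧ w < s i, s i := by
    rw [← Finset.sum_filter_add_sum_filter_not (O.filter fun i => col i = c) fun i => s i ≤ w,
      Finset.filter_filter, Finset.filter_filter]
    simp only [not_le]
  have h7 := Nat.mul_le_mul_right (L * w) h2
  have h8 := Nat.mul_le_mul_right w h4
  rw [h6]
  nlinarith

end Slotting

/-- If any two bins together contain more than `D`, then all bins but one are half full on
average. -/
theorem card_sub_one_mul_le {ι : Type} [DecidableEq ι] (W : Finset ι) (h : ι → ℕ) (D : ℕ)
    (hW : ∀ x ∈ W, ∀ y ∈ W, x ≠ y → D < h x + h y) : (W.card - 1) * D ≤ 2 * ∑ x ∈ W, h x := by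
  by_cases hx : ∃ x ∈ W, 2 * h x < D
  · obtain ⟨x, hx, hxD⟩ := hx
    rw [← Finset.card_erase_of_mem hx, ← smul_eq_mul, Finset.mul_sum]
    refine (Finset.card_nsmul_le_sum (W.erase x) (fun y => 2 * h y) _ fun y hy => ?_).trans
      (Finset.sum_le_sum_of_subset (Finset.erase_subset _ _))
    have := hW x hx y (Finset.mem_of_mem_erase hy) (Finset.ne_of_mem_erase hy).symm
    omega
  · push Not at hx
    refine (Nat.mul_le_mul_right D (Nat.sub_le _ 1)).trans ?_
    rw [← smul_eq_mul, Finset.mul_sum]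
    exact Finset.card_nsmul_le_sum W (fun y => 2 * h y) _ hx

/-! ### The candidate of a packing -/

/-- Every list of at most `X.length` elements, classified by finitely many types, is up to its order
the layout of some numbers of copies of these types. -/
theorem exists_layout_eq (X : List (ℕ × ℕ)) (τ : ℕ → List ((ℕ × ℕ) × ℕ))
    (ts : List (List ((ℕ × ℕ) × ℕ))) (l : List ℕ) (hl : ∀ b ∈ l, τ b ∈ ts)
    (hlX : l.length ≤ X.length) :
    ∃ bl : List (List ((ℕ × ℕ) × ℕ) × ℕ), bl.length = ts.length ∧
      (∀ p ∈ bl, p.1 ∈ ts ∧ p.2 ≤ X.length) ∧ ∃ bs : List ℕ, bs.Perm l ∧ layout X bl = bs.map τ := by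
  classical
  induction ts generalizing l with
  | nil =>
    have : l = [] := List.eq_nil_iff_forall_not_mem.2 fun b hb => by simpa using hl b hb
    subst this
    exact ⟨[], rfl, by simp, [], List.Perm.refl _, rfl⟩
  | cons a ts ih =>
    have h1 : (l.filter fun b => τ b = a).length ≤ X.length :=
      (List.length_filter_le _ _).trans hlX
    obtain ⟨bl, h2, h3, bs, h4, h5⟩ := ih (l.filter fun b => !decide (τ b = a)) (fun b hb => by
        rw [List.mem_filter] at hb
        rcases List.mem_cons.1 (hl b hb.1) with h | h
        · simp [h] at hb
        · exact h) ((List.length_filter_le _ _).trans hlX)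
    refine ⟨(a, (l.filter fun b => τ b = a).length) :: bl, by simp [h2], ?_,
      (l.filter fun b => τ b = a) ++ bs,
      (List.Perm.append_left _ h4).trans (List.filter_append_perm _ _), ?_⟩
    · intro p hp
      rcases List.mem_cons.1 hp with rfl | hp
      · exact ⟨List.mem_cons_self, h1⟩
      · exact ⟨List.mem_cons_of_mem _ (h3 p hp).1, (h3 p hp).2⟩
    · have h6 : layout X ((a, (l.filter fun b => τ b = a).length) :: bl) =
          ((number X).filter fun x => x.1 < (l.filter fun b => τ b = a).length).map (fun _ => a) ++
            layout X bl := rfl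
      have h7 : (l.filter fun b => τ b = a).map τ =
          List.replicate (l.filter fun b => τ b = a).length a := by
        rw [List.eq_replicate_iff]
        refine ⟨by simp, fun x hx => ?_⟩
        obtain ⟨b, hb, rfl⟩ := List.mem_map.1 hx
        simpa using (List.mem_filter.1 hb).2
      rw [h6, h5, List.map_append, h7, List.map_const', length_filter_number, min_eq_left h1]

/-- The compartments of the layout come first, then those of the additional bins; `μ` and `ν` are
the numbers of these bins. -/
theorem compartments_eq {n D : ℕ} (col s : Fin n → ℕ) (R : List (ℕ × ℕ)) (slots : ℕ → ℕ × ℕ → ℕ)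
    {bs : List ℕ} (hbs : bs.Nodup) {bl : List (List ((ℕ × ℕ) × ℕ) × ℕ)}
    (hbl : layout (List.ofFn fun i => (col i, s i)) bl =
      bs.map fun b => R.map fun r => (r, slots b r)) :
    ∃ (μ : ℕ → ℕ) (ν : Fin n → ℕ), compartments D (List.ofFn fun i => (col i, s i)) bl =
        (bs.flatMap fun b => R.map fun r => (μ b, r, slots b r * r.2)) ++
          List.ofFn (fun i => (ν i, (col i, D + 1), D)) ∧
      (∀ b ∈ bs, ∀ b' ∈ bs, μ b = μ b' → b = b') ∧ Function.Injective ν ∧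
      ∀ b ∈ bs, ∀ i, μ b ≠ ν i := by
  have hZ : (bs.map Sum.inl ++ (List.finRange n).map Sum.inr : List (ℕ ⊕ Fin n)).Nodup := by
    refine List.Nodup.append (hbs.map Sum.inl_injective)
      ((List.nodup_finRange n).map Sum.inr_injective) ?_
    intro z hz hz'
    obtain ⟨b, -, rfl⟩ := List.mem_map.1 hz
    obtain ⟨i, -, h⟩ := List.mem_map.1 hz'
    exact absurd h (by simp)
  obtain ⟨ξ, h1, h2⟩ := exists_number_eq hZ
  have hl : ∀ b ∈ bs, Sum.inl b ∈
      (bs.map Sum.inl ++ (List.finRange n).map Sum.inr : List (ℕ ⊕ Fin n)) := fun b hb =>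
    List.mem_append_left _ (List.mem_map.2 ⟨b, hb, rfl⟩)
  have hr : ∀ i, Sum.inr i ∈
      (bs.map Sum.inl ++ (List.finRange n).map Sum.inr : List (ℕ ⊕ Fin n)) := fun i =>
    List.mem_append_right _ (List.mem_map.2 ⟨i, List.mem_finRange i, rfl⟩)
  refine ⟨fun b => ξ (Sum.inl b), fun i => ξ (Sum.inr i), ?_, ?_, ?_, ?_⟩
  · have h3 : bins D (List.ofFn fun i => (col i, s i)) bl =
        (bs.map Sum.inl ++ (List.finRange n).map Sum.inr : List (ℕ ⊕ Fin n)).map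
          (Sum.elim (fun b => R.map fun r => (r, slots b r * r.2))
            fun i => [((col i, D + 1), D)]) := by
      rw [bins, hbl, List.map_append, List.map_map, List.map_map, List.map_map, List.ofFn_eq_map,
        List.map_map]
      congr 1
      refine List.map_congr_left fun b _ => ?_
      simp
    rw [compartments, h3, number_map, h1, List.map_map, List.flatMap_map, List.flatMap_append,
      List.flatMap_map, List.flatMap_map, List.ofFn_eq_map]
    congr 1
    · refine List.flatMap_congr fun b _ => ?_
      simp
    · rw [List.map_eq_flatMap]
      rfl
  · exact fun b hb b' hb' h => Sum.inl_injective (h2 _ (hl b hb) _ (hl b' hb') h)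
  · exact fun i j h => Sum.inr_injective (h2 _ (hr i) _ (hr j) h)
  · exact fun b hb i h => Sum.inl_ne_inr (h2 _ (hl b hb) _ (hr i) h)

theorem mem_of_append_eq_append_cons {α : Type} {l₁ l₂ l l' : List α} {x : α} (hx : x ∉ l₁)
    (h : l₁ ++ l₂ = l ++ x :: l') {y : α} (hy : y ∈ l₁) : y ∈ l := by
  rcases List.append_eq_append_iff.1 h with ⟨t, rfl, -⟩ | ⟨t, rfl, ht⟩
  · exact List.mem_append_left _ hy
  · cases t with
    | nil => simpa using hy
    | cons z t =>
      rw [List.cons_append, List.cons.injEq] at ht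
      exact absurd (List.mem_append_right _ (ht.1 ▸ List.mem_cons_self)) hx

theorem mem_or_mem_of_append_cons_eq {α : Type} {l l' t t' : List α} {x y : α} (hxy : x ≠ y)
    (h : l ++ x :: l' = t ++ y :: t') : x ∈ t ∨ y ∈ l := by
  rcases List.append_eq_append_iff.1 h with ⟨v, rfl, hv⟩ | ⟨v, rfl, hv⟩
  · cases v with
    | nil => exact absurd (List.cons.inj hv).1 hxy
    | cons z v => exact Or.inl (List.mem_append_right _ ((List.cons.inj hv).1 ▸ List.mem_cons_self))
  · cases v with
    | nil => exact absurd (List.cons.inj hv).1.symm hxy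
    | cons z v => exact Or.inr (List.mem_append_right _ ((List.cons.inj hv).1 ▸ List.mem_cons_self))

section
variable {n m L w : ℕ} {col s P : Fin n → ℕ} {R : Finset (ℕ × ℕ)} {slots : ℕ → ℕ × ℕ → ℕ}
  {u : Fin n → ℕ} {μ : ℕ → ℕ} {ν : Fin n → ℕ} {f : Fin n → Compartment}

/-- The result of first fit for the reserved slots of a packing and one additional bin for each
item. Either the item `i` is in a compartment for its reference, or it is in an additional bin for
its colour, and then no compartment for its reference has room for it; two additional bins for the
same colour cannot be merged. -/
structure Fitted (L w : ℕ) (col s P : Fin n → ℕ) (R : Finset (ℕ × ℕ)) (slots : ℕ → ℕ × ℕ → ℕ)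
    (u : Fin n → ℕ) (μ : ℕ → ℕ) (ν : Fin n → ℕ) (f : Fin n → Compartment) : Prop where
  μ_inj : ∀ b ∈ Finset.univ.image P, ∀ b' ∈ Finset.univ.image P, μ b = μ b' → b = b'
  ν_inj : Function.Injective ν
  μ_ne_ν : ∀ b ∈ Finset.univ.image P, ∀ i, μ b ≠ ν i
  fits : ∀ b ∈ Finset.univ.image P, ∀ r ∈ R,
    ∑ i with f i = (μ b, r, slots b r * r.2), s i ≤ slots b r * r.2
  fits' : ∀ i, ∑ j with f j = (ν i, (col i, L * w + 1), L * w), s j ≤ L * w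
  cases : ∀ i, (∃ b ∈ Finset.univ.image P, (col i, u i) ∈ R ∧
      f i = (μ b, (col i, u i), slots b (col i, u i) * u i)) ∨
    ((∃ j, col j = col i ∧ f i = (ν j, (col j, L * w + 1), L * w)) ∧
      ∀ b ∈ Finset.univ.image P, (col i, u i) ∈ R → slots b (col i, u i) * u i <
        ∑ j with f j = (μ b, (col i, u i), slots b (col i, u i) * u i), s j + s i)
  pairs : ∀ i j i' j', col j = col j' → j ≠ j' → f i = (ν j, (col j, L * w + 1), L * w) →
    f i' = (ν j', (col j', L * w + 1), L * w) →
    L * w < ∑ k with f k = (ν j, (col j, L * w + 1), L * w), s k +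
      ∑ k with f k = (ν j', (col j', L * w + 1), L * w), s k

theorem exists_fitted {bs : List ℕ} (h : Slotting m L w col s P R slots u) (hw : 0 < w)
    (hP : ∀ b, ∑ i with P i = b, s i ≤ L * w)
    (hbs : bs.Nodup) (hbs' : ∀ b, b ∈ bs ↔ b ∈ Finset.univ.image P)
    {bl : List (List ((ℕ × ℕ) × ℕ) × ℕ)} (hbl : layout (List.ofFn fun i => (col i, s i)) bl =
      bs.map fun b => R.toList.map fun r => (r, slots b r)) :
    ∃ μ ν f, Fitted L w col s P R slots u μ ν f ∧
      pack (L * w) (List.ofFn fun i => (col i, s i)) R.toList bl =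
        List.ofFn fun i => ((f i).1, col i, s i) := by
  classical
  obtain ⟨μ, ν, hK, hμ, hν, hμν⟩ :=
    compartments_eq (D := L * w) col s R.toList slots hbs hbl
  obtain ⟨f, hf, hcap, hff⟩ := firstFit_ofFn (L * w)
    (compartments (L * w) (List.ofFn fun i => (col i, s i)) bl) fun i => (col i, u i, s i)
  have hpack : pack (L * w) (List.ofFn fun i => (col i, s i)) R.toList bl =
      List.ofFn fun i => ((f i).1, col i, s i) := by
    have h1 : classed (L * w) R.toList (List.ofFn fun i => (col i, s i)) =
        List.ofFn fun i => (col i, u i, s i) := by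
      rw [classed, List.map_ofFn]
      congr 1
      funext i
      simp only [Function.comp_apply, h.u_eq]
    rw [pack, h1, hf, List.map_ofFn]
    rfl
  refine ⟨μ, ν, f, ?_, hpack⟩
  rw [hK] at hff hcap
  generalize compartments (L * w) (List.ofFn fun i => (col i, s i)) bl = K at *
  simp only at hcap hff
  have hsD : ∀ i, s i ≤ L * w := fun i =>
    le_trans (Finset.single_le_sum (f := s) (s := Finset.univ.filter fun j => P j = P i)
      (fun _ _ => Nat.zero_le _) (Finset.mem_filter.2 ⟨Finset.mem_univ i, rfl⟩)) (hP (P i))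
  have hmem1 : ∀ κ : Compartment, κ ∈ (bs.flatMap fun b => R.toList.map fun r =>
      ((μ b, r, slots b r * r.2) : Compartment)) ↔
      ∃ b ∈ Finset.univ.image P, ∃ r ∈ R, κ = (μ b, r, slots b r * r.2) := by
    intro κ
    simp only [List.mem_flatMap, List.mem_map, Finset.mem_toList, hbs', eq_comm (b := κ)]
  have hmem2 : ∀ κ : Compartment, κ ∈ (List.ofFn fun i =>
      ((ν i, (col i, L * w + 1), L * w) : Compartment)) ↔
      ∃ j, κ = (ν j, (col j, L * w + 1), L * w) := by
    intro κ
    simp only [List.mem_ofFn, eq_comm (b := κ)]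
  generalize hK1 : (bs.flatMap fun b => R.toList.map fun r =>
      ((μ b, r, slots b r * r.2) : Compartment)) = K1 at *
  generalize hK2 : (List.ofFn fun i =>
      ((ν i, (col i, L * w + 1), L * w) : Compartment)) = K2 at *
  have hno : ∀ j, ((ν j, (col j, L * w + 1), L * w) : Compartment) ∉ K1 := by
    intro j hj
    obtain ⟨b, -, r, hr, hjr⟩ := (hmem1 _).1 hj
    have h1 := h.ref_le r hr
    have h2 : r = (col j, L * w + 1) := by
      have := congrArg (fun κ : Compartment => κ.2.1) hjr
      exact this.symm
    rw [h2] at h1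
    simp at h1
  have hcolf : ∀ i j, f i = (ν j, (col j, L * w + 1), L * w) → col j = col i := by
    intro i j hij
    rcases hff i with ⟨_, _, _, h1, _⟩ | ⟨h1, _⟩
    · rw [hij] at h1; exact h1.1
    · rw [hij] at h1
      simp at h1
  -- First fit never fails: a failure at `i` would need as many other items of the same colour as
  -- there are additional bins for this colour.
  have hok : ∀ i, ¬ (f i = (0, (0, 0), 0) ∧ ∀ κ ∈ K1 ++ K2, Accepts (L * w) κ (col i, u i, s i) →
      κ.2.2 < ∑ j with f j = κ, s j + s i) := by
    rintro i ⟨h1, h2⟩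
    have h3 : ∀ j, col j = col i → ∃ i', f i' = (ν j, (col j, L * w + 1), L * w) := by
      intro j hj
      have h4 := h2 _ (List.mem_append_right _ ((hmem2 _).2 ⟨j, rfl⟩)) ⟨hj, Or.inr rfl⟩
      have h5 := hsD i
      obtain ⟨i', hi', -⟩ := Finset.exists_ne_zero_of_sum_ne_zero
        (show ∑ k with f k = (ν j, (col j, L * w + 1), L * w), s k ≠ 0 by
          simp only at h4; omega)
      exact ⟨i', (Finset.mem_filter.1 hi').2⟩
    choose! g hg using h3
    have h4 : (Finset.univ.filter fun j => col j = col i).card ≤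
        ((Finset.univ.filter fun j => col j = col i).erase i).card := by
      refine Finset.card_le_card_of_injOn g (fun j hj => ?_) fun j hj j' hj' hjj => ?_
      · have hj' := (Finset.mem_filter.1 hj).2
        rw [Finset.mem_coe, Finset.mem_erase, Finset.mem_filter]
        refine ⟨fun h5 => ?_, Finset.mem_univ _, ?_⟩
        · have := hg j hj'
          rw [h5, h1] at this
          simp at this
        · rw [← hcolf _ _ (hg j hj'), hj']
      · have h5 := hg j (Finset.mem_filter.1 hj).2
        rw [hjj, hg j' (Finset.mem_filter.1 hj').2, Prod.mk.injEq] at h5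
        exact (hν h5.1).symm
    have h5 := Finset.card_erase_lt_of_mem
      (show i ∈ Finset.univ.filter fun j => col j = col i by simp)
    omega
  have hff' := fun i => (hff i).resolve_right (hok i)
  refine ⟨fun b hb b' hb' => hμ b ((hbs' b).2 hb) b' ((hbs' b').2 hb'), hν,
    fun b hb => hμν b ((hbs' b).2 hb), ?_, ?_, ?_, ?_⟩
  · intro b hb r hr
    refine hcap _ (List.mem_append_left _ ((hmem1 _).2 ⟨b, hb, r, hr, rfl⟩)) ?_
    exact (hw.trans_le (h.le_ref r hr)).ne'
  · intro i
    exact hcap _ (List.mem_append_right _ ((hmem2 _).2 ⟨i, rfl⟩)) (Nat.succ_ne_zero _)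
  · intro i
    obtain ⟨l, l', h1, h2, h3⟩ := hff' i
    have h4 : f i ∈ K1 ++ K2 := by rw [h1]; simp
    rcases List.mem_append.1 h4 with h4 | h4
    · left
      obtain ⟨b, hb, r, hr, hfi⟩ := (hmem1 _).1 h4
      rw [hfi] at h2
      have h5 : r = (col i, u i) := by
        refine Prod.ext h2.1 (h2.2.resolve_right fun h5 => ?_)
        have := h.ref_le r hr
        simp only at h5
        omega
      subst h5
      exact ⟨b, hb, hr, hfi⟩
    · right
      obtain ⟨j, hj⟩ := (hmem2 _).1 h4
      refine ⟨⟨j, hcolf i j hj, hj⟩, fun b hb hR => ?_⟩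
      rw [hj] at h1
      exact h3 _ (mem_of_append_eq_append_cons (hno j) h1 ((hmem1 _).2 ⟨b, hb, _, hR, rfl⟩))
        ⟨rfl, Or.inl rfl⟩
  · intro i j i' j' hjj hne hi hi'
    obtain ⟨l, l', h1, h2, h3⟩ := hff' i
    obtain ⟨t, t', h4, h5, h6⟩ := hff' i'
    have hin : ∀ i κ, f i = κ → s i ≤ ∑ k with f k = κ, s k := fun i κ hi =>
      Finset.single_le_sum (f := s) (fun _ _ => Nat.zero_le _)
        (Finset.mem_filter.2 ⟨Finset.mem_univ i, hi⟩)
    have h7 := hin _ _ hi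
    have h8 := hin _ _ hi'
    rw [hi] at h1
    rw [hi'] at h4
    rcases mem_or_mem_of_append_cons_eq (fun h9 => hne (hν (congrArg Prod.fst h9)))
      (h1.symm.trans h4) with h9 | h9
    · have := h6 _ h9 ⟨hjj.trans (hcolf _ _ hi'), Or.inr rfl⟩
      simp only at this
      omega
    · have := h3 _ h9 ⟨hjj.symm.trans (hcolf _ _ hi), Or.inr rfl⟩
      simp only at this
      omega

namespace Fitted

theorem sum_bin_le (F : Fitted L w col s P R slots u μ ν f)
    (h : Slotting m L w col s P R slots u) (i : Fin n) :
    ∑ j with (f j).1 = (f i).1, s j ≤ L * w := by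
  classical
  rcases F.cases i with ⟨b, hb, -, hi⟩ | ⟨⟨j, -, hi⟩, -⟩
  · have h1 : (Finset.univ.filter fun j => (f j).1 = (f i).1) ⊆
        R.biUnion fun r => Finset.univ.filter fun j => f j = (μ b, r, slots b r * r.2) := by
      intro k hk
      have hk := (Finset.mem_filter.1 hk).2
      rw [hi] at hk
      rcases F.cases k with ⟨b', hb', hR, hfk⟩ | ⟨⟨j, -, hfk⟩, -⟩
      · have h2 : b' = b := F.μ_inj b' hb' b hb (by rw [hfk] at hk; exact hk)
        subst h2
        exact Finset.mem_biUnion.2 ⟨_, hR, Finset.mem_filter.2 ⟨Finset.mem_univ _, hfk⟩⟩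
      · rw [hfk] at hk
        exact absurd hk.symm (F.μ_ne_ν b hb j)
    refine (Finset.sum_le_sum_of_subset h1).trans (le_trans ?_ (h.sum_le b))
    rw [Finset.sum_biUnion]
    · exact Finset.sum_le_sum fun r hr => F.fits b hb r hr
    · intro r _ r' _ hrr
      refine Finset.disjoint_filter.2 fun k _ hk hk' => hrr ?_
      rw [hk] at hk'
      exact congrArg (fun κ : Compartment => κ.2.1) hk'
  · refine (Finset.sum_le_sum_of_subset fun k hk => ?_).trans (F.fits' j)
    have hk := (Finset.mem_filter.1 hk).2
    rw [hi] at hk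
    refine Finset.mem_filter.2 ⟨Finset.mem_univ _, ?_⟩
    rcases F.cases k with ⟨b', hb', hR, hfk⟩ | ⟨⟨j', -, hfk⟩, -⟩
    · rw [hfk] at hk
      exact absurd hk (F.μ_ne_ν b' hb' j)
    · rw [hfk] at hk
      rw [hfk, F.ν_inj hk]

/-- The number of additional bins for the colour `c`. -/
theorem card_additional_le (F : Fitted L w col s P R slots u μ ν f)
    (h : Slotting m L w col s P R slots u) (hL : 0 < L) (hw : 0 < w)
    (hP : ∀ b, ∑ i with P i = b, s i ≤ L * w) (c : ℕ) :
    L * (Finset.univ.filter fun j => col j = c ∧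
      ∃ i, f i = (ν j, (col j, L * w + 1), L * w)).card ≤
      6 * (spanned col P c).card + 3 * L := by
  classical
  have h1 := h.overflow_le hL hw hP
    (Finset.univ.filter fun i => ∃ j, f i = (ν j, (col j, L * w + 1), L * w))
    (fun b r => Finset.univ.filter fun i =>
      b ∈ Finset.univ.image P ∧ f i = (μ b, r, slots b r * r.2))
    (fun b r i hi => by
      obtain ⟨-, hb, hi⟩ := Finset.mem_filter.1 hi
      refine ⟨fun hO => ?_, ?_⟩
      · obtain ⟨-, j, hj⟩ := Finset.mem_filter.1 hO
        rw [hi] at hj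
        exact F.μ_ne_ν b hb j (congrArg Prod.fst hj)
      · rcases F.cases i with ⟨b', -, -, hi'⟩ | ⟨⟨j, -, hj⟩, -⟩
        · rw [hi] at hi'
          exact (congrArg (fun κ : Compartment => κ.2.1) hi').symm
        · rw [hi] at hj
          exact absurd (congrArg Prod.fst hj) (F.μ_ne_ν b hb j))
    (fun r b b' hb hb' hbb => by
      refine Finset.disjoint_filter.2 fun i _ hi hi' => hbb (F.μ_inj b hb b' hb' ?_)
      have := hi.2.symm.trans hi'.2
      exact congrArg Prod.fst this)
    (fun i hi b hb hR => by
      obtain ⟨-, j, hj⟩ := Finset.mem_filter.1 hi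
      rcases F.cases i with ⟨b', hb', -, hi'⟩ | ⟨-, hi'⟩
      · rw [hi'] at hj
        exact absurd (congrArg Prod.fst hj) (F.μ_ne_ν b' hb' j)
      · simpa only [hb, true_and] using hi' b hb hR) c
  have h2 := card_sub_one_mul_le (Finset.univ.filter fun j => col j = c ∧
      ∃ i, f i = (ν j, (col j, L * w + 1), L * w))
    (fun j => ∑ k with f k = (ν j, (col j, L * w + 1), L * w), s k) (L * w)
    (fun j hj j' hj' hne => by
      obtain ⟨-, hj1, i, hi⟩ := Finset.mem_filter.1 hj
      obtain ⟨-, hj2, i', hi'⟩ := Finset.mem_filter.1 hj'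
      exact F.pairs i j i' j' (hj1.trans hj2.symm) hne hi hi')
  have h3 : ∑ j with col j = c ∧ ∃ i, f i = (ν j, (col j, L * w + 1), L * w),
      ∑ k with f k = (ν j, (col j, L * w + 1), L * w), s k ≤
      ∑ i ∈ Finset.univ.filter (fun i => ∃ j, f i = (ν j, (col j, L * w + 1), L * w))
        with col i = c, s i := by
    rw [← Finset.sum_biUnion]
    · refine Finset.sum_le_sum_of_subset fun i hi => ?_
      obtain ⟨j, hj, hi⟩ := Finset.mem_biUnion.1 hi
      have hi := (Finset.mem_filter.1 hi).2
      refine Finset.mem_filter.2 ⟨Finset.mem_filter.2 ⟨Finset.mem_univ _, j, hi⟩, ?_⟩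
      rcases F.cases i with ⟨b', hb', -, hi'⟩ | ⟨⟨j', hj', hi'⟩, -⟩
      · rw [hi'] at hi
        exact absurd (congrArg Prod.fst hi) (F.μ_ne_ν b' hb' j)
      · rw [hi'] at hi
        rw [← hj', F.ν_inj (congrArg Prod.fst hi)]
        exact (Finset.mem_filter.1 hj).2.1
    · intro j _ j' _ hne
      refine Finset.disjoint_filter.2 fun k _ hk hk' => hne (F.ν_inj ?_)
      rw [hk] at hk'
      exact congrArg Prod.fst hk'
  generalize (Finset.univ.filter fun j => col j = c ∧
      ∃ i, f i = (ν j, (col j, L * w + 1), L * w)).card = x at h2 ⊢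
  have h4 : (x - 1) * L ≤ 6 * (spanned col P c).card + 2 * L := by
    refine Nat.le_of_mul_le_mul_right (c := w) ?_ hw
    have := (h2.trans (Nat.mul_le_mul_left 2 (h3.trans h1)))
    calc (x - 1) * L * w = (x - 1) * (L * w) := mul_assoc _ _ _
      _ ≤ _ := this
      _ = _ := by ring
  have h5 : L * x ≤ (x - 1) * L + L := by
    cases x with
    | zero => simp
    | succ x => rw [Nat.add_sub_cancel]; exact (by ring : L * (x + 1) = x * L + L).le
  omega

theorem mem_spanned (F : Fitted L w col s P R slots u μ ν f)
    (h : Slotting m L w col s P R slots u) (hs : ∀ i, 0 < s i) (i : Fin n) :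
    (∃ b ∈ spanned col P (col i), (f i).1 = μ b) ∨
      ∃ j, col j = col i ∧ f i = (ν j, (col j, L * w + 1), L * w) := by
  rcases F.cases i with ⟨b, hb, hR, hi⟩ | ⟨hi, -⟩
  · left
    have h1 := (Finset.single_le_sum (f := s) (s := Finset.univ.filter fun j => f j =
      (μ b, (col i, u i), slots b (col i, u i) * u i)) (fun _ _ => Nat.zero_le _)
      (Finset.mem_filter.2 ⟨Finset.mem_univ i, hi⟩)).trans (F.fits b hb _ hR)
    have h2 : slots b (col i, u i) ≠ 0 := fun h0 => by
      rw [h0, Nat.zero_mul] at h1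
      exact absurd h1 (hs i).not_ge
    obtain ⟨j, hj, hj'⟩ := h.exists_of_ne _ _ h2
    refine ⟨b, ?_, by rw [hi]⟩
    rw [← hj]
    exact Finset.mem_image_of_mem P (Finset.mem_filter.2 ⟨Finset.mem_univ _, hj'⟩)
  · exact Or.inr hi

theorem card_spanned_le (F : Fitted L w col s P R slots u μ ν f)
    (h : Slotting m L w col s P R slots u) (hL : 0 < L) (hw : 0 < w) (hs : ∀ i, 0 < s i)
    (hP : ∀ b, ∑ i with P i = b, s i ≤ L * w) (c : ℕ) :
    L * (spanned col (fun i => (f i).1) c).card ≤ (L + 6) * (spanned col P c).card + 3 * L := by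
  classical
  have h1 : spanned col (fun i => (f i).1) c ⊆ (spanned col P c).image μ ∪
      (Finset.univ.filter fun j => col j = c ∧
        ∃ i, f i = (ν j, (col j, L * w + 1), L * w)).image ν := by
    intro x hx
    obtain ⟨i, hi, rfl⟩ := Finset.mem_image.1 hx
    have hc := (Finset.mem_filter.1 hi).2
    rcases F.mem_spanned h hs i with ⟨b, hb, hi⟩ | ⟨j, hj, hi⟩
    · exact Finset.mem_union_left _ (Finset.mem_image.2 ⟨b, hc ▸ hb, hi.symm⟩)
    · exact Finset.mem_union_right _ (Finset.mem_image.2 ⟨j, Finset.mem_filter.2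
        ⟨Finset.mem_univ _, hj.trans hc, i, hi⟩, by rw [hi]⟩)
  have h2 := (Finset.card_le_card h1).trans ((Finset.card_union_le _ _).trans
    (Nat.add_le_add Finset.card_image_le Finset.card_image_le))
  have h3 := F.card_additional_le h hL hw hP c
  nlinarith [Nat.mul_le_mul_left L h2]

theorem card_bins_le (F : Fitted L w col s P R slots u μ ν f)
    (h : Slotting m L w col s P R slots u) (hL : 0 < L) (hw : 0 < w) (hs : ∀ i, 0 < s i)
    (hcol : ∀ i, col i < m) (hP : ∀ b, ∑ i with P i = b, s i ≤ L * w) :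
    L * (Finset.univ.image fun i => (f i).1).card ≤
      (L + 6 * m) * (Finset.univ.image P).card + 3 * L * m := by
  classical
  have h1 : (Finset.univ.image fun i => (f i).1) ⊆ (Finset.univ.image P).image μ ∪
      (Finset.range m).biUnion fun c => (Finset.univ.filter fun j => col j = c ∧
        ∃ i, f i = (ν j, (col j, L * w + 1), L * w)).image ν := by
    intro x hx
    obtain ⟨i, -, rfl⟩ := Finset.mem_image.1 hx
    rcases F.mem_spanned h hs i with ⟨b, hb, hi⟩ | ⟨j, hj, hi⟩
    · exact Finset.mem_union_left _ (Finset.mem_image.2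
        ⟨b, Finset.image_subset_image (Finset.filter_subset _ _) hb, hi.symm⟩)
    · exact Finset.mem_union_right _ (Finset.mem_biUnion.2 ⟨col i, Finset.mem_range.2 (hcol i),
        Finset.mem_image.2 ⟨j, Finset.mem_filter.2 ⟨Finset.mem_univ _, hj, i, hi⟩, by rw [hi]⟩⟩)
  have h2 := (Finset.card_le_card h1).trans ((Finset.card_union_le _ _).trans
    (Nat.add_le_add Finset.card_image_le (Finset.card_biUnion_le.trans
      (Finset.sum_le_sum fun c _ => Finset.card_image_le))))
  have h3 : ∑ c ∈ Finset.range m, L * (Finset.univ.filter fun j => col j = c ∧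
      ∃ i, f i = (ν j, (col j, L * w + 1), L * w)).card ≤
      m * (6 * (Finset.univ.image P).card + 3 * L) := by
    have h4 := Finset.sum_le_card_nsmul (Finset.range m)
      (fun c => L * (Finset.univ.filter fun j => col j = c ∧
        ∃ i, f i = (ν j, (col j, L * w + 1), L * w)).card)
      (6 * (Finset.univ.image P).card + 3 * L) fun c _ =>
        (F.card_additional_le h hL hw hP c).trans (by
          have := ColouredBinPacking.card_spanned_le col P c
          omega)
    rwa [Finset.card_range, smul_eq_mul] at h4
  rw [← Finset.mul_sum] at h3
  have h4 := Nat.mul_le_mul_left L h2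
  rw [mul_add] at h4
  calc _ ≤ _ := h4
    _ ≤ L * (Finset.univ.image P).card + m * (6 * (Finset.univ.image P).card + 3 * L) :=
      Nat.add_le_add_left h3 _
    _ = _ := by ring

end Fitted
end

/-! ### Packings and candidates -/

/-- The items of an instance as triples of numbers. -/
def Instance.raw {m : ℕ} (I : Instance m) : List (ℕ × ℕ × ℕ) :=
  I.map fun e => ((e.colour : ℕ), e.size.num.toNat, e.size.den)

/-- The colours of the items of an instance as numbers. -/
def Instance.col {m : ℕ} (I : Instance m) (i : Fin I.length) : ℕ := (I.get i).colour

theorem denom_pos {m : ℕ} (I : Instance m) : 0 < denom I.raw := by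
  refine Nat.pos_of_ne_zero fun h => ?_
  rw [denom, List.prod_eq_zero_iff] at h
  obtain ⟨x, hx, h0⟩ := List.mem_map.1 h
  obtain ⟨e, -, rfl⟩ := List.mem_map.1 hx
  exact e.size.den_nz h0

theorem exists_scaled {m : ℕ} (L : ℕ) (I : Instance m) : ∃ s : Fin I.length → ℕ,
    scaled L I.raw = List.ofFn (fun i => (I.col i, s i)) ∧
    ∀ i, (s i : ℚ) = (I.get i).size * (L * denom I.raw : ℕ) := by
  have hlen : (number I.raw).length = I.length := by
    rw [length_number, Instance.raw, List.length_map]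
  have h2 : ∀ i : Fin I.length, ((number I.raw)[(i : ℕ)]'(by omega)).2 =
      (((I.get i).colour : ℕ), (I.get i).size.num.toNat, (I.get i).size.den) := by
    intro i
    have h3 : ((number I.raw).map fun x => x.2)[(i : ℕ)]? = I.raw[(i : ℕ)]? := by
      rw [map_snd_number]
    have h4 : (i : ℕ) < (number I.raw).length := by omega
    rw [List.getElem?_map, List.getElem?_eq_getElem h4, Option.map_some] at h3
    simpa [Instance.raw] using h3
  refine ⟨fun i => L * ((number I.raw)[(i : ℕ)]'(by omega)).2.2.1 *
    ((number I.raw).map fun y => if y.1 = ((number I.raw)[(i : ℕ)]'(by omega)).1 then 1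
      else y.2.2.2).prod, ?_, fun i => ?_⟩
  · refine List.ext_getElem (by simp [scaled, hlen]) fun i hi hi' => ?_
    simp only [scaled, List.getElem_map, List.getElem_ofFn]
    rw [List.length_ofFn] at hi'
    have := h2 ⟨i, hi'⟩
    simp only at this
    rw [this]
    rfl
  · have h3 := prod_map_number_mul (l := I.raw) (fun e => e.2.2)
      (List.getElem_mem (show (i : ℕ) < (number I.raw).length by omega))
    simp only [h2 i] at h3 ⊢
    rw [denom, ← h3]
    have h4 : (((I.get i).size.num.toNat : ℕ) : ℚ) = (I.get i).size * (I.get i).size.den := by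
      rw [Rat.mul_den_eq_num, ← Int.cast_natCast, Int.toNat_of_nonneg]
      exact (Rat.num_pos.2 (I.get i).size_pos).le
    push_cast
    rw [h4]
    ring

section
variable {m L : ℕ} {I : Instance m} {s : Fin I.length → ℕ}

theorem size_scale (hs : ∀ i, (s i : ℚ) = (I.get i).size * (L * denom I.raw : ℕ))
    (hL : 0 < L) (t : Finset (Fin I.length)) :
    ∑ i ∈ t, s i ≤ L * denom I.raw ↔ ∑ i ∈ t, (I.get i).size ≤ 1 := by
  have h0 : (0 : ℚ) < (L * denom I.raw : ℕ) := Nat.cast_pos.2 (Nat.mul_pos hL (denom_pos I))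
  rw [← Nat.cast_le (α := ℚ), Nat.cast_sum, Finset.sum_congr rfl fun i _ => hs i,
    ← Finset.sum_mul]
  exact mul_le_iff_le_one_left h0

/-- A packing as a list of triples of a bin, and the colour and the scaled size of an item: the form
of the candidates of the algorithm. -/
def Packing.triples (P : Packing I) (s : Fin I.length → ℕ) : List (ℕ × ℕ × ℕ) :=
  List.ofFn fun i => (P.bin i, I.col i, s i)

theorem Packing.numBins_triples (P : Packing I) (s : Fin I.length → ℕ) :
    numBins (P.triples s) = P.bins := by
  rw [numBins, length_distinct, Packing.bins, Packing.triples, List.map_ofFn]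
  congr 1
  ext b
  simp [List.mem_ofFn]

theorem Packing.span_eq (P : Packing I) (c : Fin m) :
    P.span c = (spanned I.col P.bin c).card := by
  simp only [Packing.span, spanned, Instance.col, Fin.val_inj]

theorem Packing.numSpan_triples (P : Packing I) (s : Fin I.length → ℕ) (c : Fin m) :
    numSpan c (P.triples s) = P.span c := by
  rw [numSpan, length_distinct, P.span_eq, Packing.triples, spanned]
  congr 1
  ext b
  simp only [List.mem_toFinset, List.mem_map, List.mem_filter, List.mem_ofFn, Finset.mem_image,
    Finset.mem_filter, Finset.mem_univ, true_and, decide_eq_true_eq]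
  constructor
  · rintro ⟨_, ⟨⟨i, rfl⟩, h⟩, rfl⟩
    exact ⟨i, h, rfl⟩
  · rintro ⟨i, h, rfl⟩
    exact ⟨_, ⟨⟨i, rfl⟩, h⟩, rfl⟩

theorem fits_iff {n D : ℕ} (g c s : Fin n → ℕ) :
    Fits D (List.ofFn fun i => (g i, c i, s i)) ↔ ∀ i, ∑ j with g j = g i, s j ≤ D := by
  simp only [Fits, List.forall_mem_ofFn_iff, List.map_ofFn, List.sum_ofFn, Function.comp_def,
    Finset.sum_filter]

theorem exists_packing_of_mem_candidates {T M : ℕ} (hL : 0 < L)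
    (hX : scaled L I.raw = List.ofFn (fun i => (I.col i, s i)))
    (hs : ∀ i, (s i : ℚ) = (I.get i).size * (L * denom I.raw : ℕ)) {a : List (ℕ × ℕ × ℕ)}
    (ha : a ∈ candidates m L T M I.raw) : ∃ P : Packing I, a = P.triples s := by
  rw [candidates, List.mem_filter, List.mem_flatMap, hX, decide_eq_true_eq] at ha
  obtain ⟨⟨R, -, h⟩, hfit⟩ := ha
  obtain ⟨bl, -, rfl⟩ := List.mem_map.1 h
  obtain ⟨f, hf, -⟩ := firstFit_ofFn (L * denom I.raw)
    (compartments (L * denom I.raw) (List.ofFn fun i => (I.col i, s i)) bl)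
    fun i => (I.col i, unit (L * denom I.raw) R (I.col i, s i), s i)
  have h1 : pack (L * denom I.raw) (List.ofFn fun i => (I.col i, s i)) R bl =
      List.ofFn fun i => ((f i).1, I.col i, s i) := by
    have h2 : classed (L * denom I.raw) R (List.ofFn fun i => (I.col i, s i)) =
        List.ofFn fun i => (I.col i, unit (L * denom I.raw) R (I.col i, s i), s i) := by
      rw [classed, List.map_ofFn]
      rfl
    rw [pack, h2, hf, List.map_ofFn]
    rfl
  rw [h1, fits_iff] at hfit
  refine ⟨⟨fun i => (f i).1, fun b => ?_⟩, h1⟩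
  rcases Finset.eq_empty_or_nonempty (Finset.univ.filter fun i => (f i).1 = b) with h0 | ⟨i, hi⟩
  · rw [h0]; simp
  · obtain ⟨-, rfl⟩ := Finset.mem_filter.1 hi
    exact (size_scale hs hL _).1 (hfit i)

/-- Every packing is approximated by a candidate. -/
theorem exists_candidate (hL : 0 < L)
    (hX : scaled L I.raw = List.ofFn (fun i => (I.col i, s i)))
    (hs : ∀ i, (s i : ℚ) = (I.get i).size * (L * denom I.raw : ℕ)) (P : Packing I) :
    ∃ Q : Packing I, Q.triples s ∈
        candidates m L (m * (L ^ 2 + 2)) ((L + 1) ^ (m * (L ^ 2 + 2))) I.raw ∧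
      (∀ c, L * Q.span c ≤ (L + 6) * P.span c + 3 * L) ∧
      L * Q.bins ≤ (L + 6 * m) * P.bins + 3 * L * m := by
  classical
  have hw := denom_pos I
  have hs0 : ∀ i, 0 < s i := fun i => by
    have h1 : (0 : ℚ) < s i := by
      rw [hs]
      exact mul_pos (I.get i).size_pos (Nat.cast_pos.2 (Nat.mul_pos hL hw))
    exact_mod_cast h1
  have hcol : ∀ i, I.col i < m := fun i => (I.get i).colour.2
  have hP : ∀ b, ∑ i with P.bin i = b, s i ≤ L * denom I.raw := fun b =>
    (size_scale hs hL _).2 (P.fits b)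
  obtain ⟨R, slots, u, h⟩ := exists_slotting (s := s) hL hw hcol hP
  obtain ⟨bl, h1, h2, bs, h3, h4⟩ := exists_layout_eq (List.ofFn fun i => (I.col i, s i))
    (fun b => R.toList.map fun r => (r, slots b r))
    ((Finset.univ.image P.bin).image fun b => R.toList.map fun r => (r, slots b r)).toList
    (Finset.univ.image P.bin).toList
    (fun b hb => Finset.mem_toList.2 (Finset.mem_image_of_mem _ (Finset.mem_toList.1 hb)))
    (by
      rw [Finset.length_toList, List.length_ofFn]
      exact Finset.card_image_le.trans (Finset.card_univ.trans (Fintype.card_fin _)).le)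
  obtain ⟨μ, ν, f, F, hpack⟩ := exists_fitted h hw hP (h3.nodup_iff.2 (Finset.nodup_toList _))
    (fun b => h3.mem_iff.trans Finset.mem_toList) h4
  have hfit := F.sum_bin_le h
  -- There are at most `L + 1` possible numbers of slots for each reference.
  have hcard : bl.length ≤ (L + 1) ^ (m * (L ^ 2 + 2)) := by
    rw [h1, Finset.length_toList]
    have h5 : ((Finset.univ.image P.bin).image fun b => R.toList.map fun r => (r, slots b r)) ⊆
        (Finset.univ : Finset (R → Fin (L + 1))).image fun φ => R.toList.map fun r =>
          (r, if hr : r ∈ R then (φ ⟨r, hr⟩ : ℕ) else 0) := by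
      intro t ht
      obtain ⟨b, -, rfl⟩ := Finset.mem_image.1 ht
      refine Finset.mem_image.2 ⟨fun r => ⟨slots b r, Nat.lt_succ_of_le (h.slots_le hw b r.2)⟩,
        Finset.mem_univ _, List.map_congr_left fun r hr => ?_⟩
      rw [dif_pos (Finset.mem_toList.1 hr)]
    refine (Finset.card_le_card h5).trans (Finset.card_image_le.trans ?_)
    rw [Finset.card_univ, Fintype.card_fun, Fintype.card_fin, Fintype.card_coe]
    exact Nat.pow_le_pow_right (Nat.succ_pos L) h.card_le
  have hmem : (List.ofFn fun i => ((f i).1, I.col i, s i)) ∈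
      candidates m L (m * (L ^ 2 + 2)) ((L + 1) ^ (m * (L ^ 2 + 2))) I.raw := by
    rw [candidates, List.mem_filter, List.mem_flatMap, hX, decide_eq_true_eq]
    refine ⟨⟨R.toList, mem_choices.2 ⟨(Finset.length_toList R).trans_le h.card_le, fun r hr => ?_⟩,
      List.mem_map.2 ⟨bl, mem_choices.2 ⟨hcard, fun p hp => ?_⟩, hpack⟩⟩, (fits_iff _ _ _).2 hfit⟩
    · rw [List.mem_append, List.mem_map, List.mem_ofFn]
      rcases h.mem_pool r (Finset.mem_toList.1 hr) with ⟨h5, h6⟩ | ⟨i, hi⟩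
      · exact Or.inl ⟨r.1, List.mem_range.2 h5, Prod.ext rfl h6.symm⟩
      · exact Or.inr ⟨i, hi.symm⟩
    · obtain ⟨h5, h6⟩ := h2 p hp
      refine List.mem_flatMap.2 ⟨p.1, mem_choices.2 ?_, List.mem_map.2 ⟨p.2, ?_, rfl⟩⟩
      · obtain ⟨b, -, hb⟩ := Finset.mem_image.1 (Finset.mem_toList.1 h5)
        rw [← hb]
        refine ⟨by rw [List.length_map, Finset.length_toList]; exact h.card_le, fun q hq => ?_⟩
        obtain ⟨r, hr, rfl⟩ := List.mem_map.1 hq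
        exact List.mem_flatMap.2 ⟨r, hr, List.mem_map.2 ⟨_, List.mem_range.2
          (Nat.lt_succ_of_le (h.slots_le hw b (Finset.mem_toList.1 hr))), rfl⟩⟩
      · rcases h6.lt_or_eq with h6 | h6
        · exact List.mem_cons_of_mem _ (mem_number_fst h6)
        · exact h6 ▸ List.mem_cons_self
  obtain ⟨Q, hQ⟩ := exists_packing_of_mem_candidates hL hX hs hmem
  have hQb : Q.bin = fun i => (f i).1 := by
    funext i
    exact congrArg Prod.fst (congrFun (List.ofFn_injective hQ) i).symm
  refine ⟨Q, hQ ▸ hmem, fun c => ?_, ?_⟩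
  · rw [Q.span_eq, P.span_eq, hQb]
    exact F.card_spanned_le h hL hw hs0 hP c
  · rw [Packing.bins, Packing.bins, hQb]
    exact F.card_bins_le h hL hw hs0 hcol hP

end

/-! ### Sub-instances of one colour -/

theorem exists_embedding_ofColour {m : ℕ} (I : Instance m) (c : Fin m) :
    ∃ e : Fin (I.ofColour c).length → Fin I.length, Function.Injective e ∧
      (∀ j, (I.ofColour c).get j = I.get (e j)) ∧
      ∀ i, (I.get i).colour = c ↔ ∃ j, e j = i := by
  obtain ⟨e, he⟩ := List.sublist_iff_exists_fin_orderEmbedding_get_eq.1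
    (List.filter_sublist (l := I) (p := fun e => decide (e.colour = c)))
  have hsub : Finset.univ.image e ⊆ Finset.univ.filter fun i => (I.get i).colour = c := by
    intro i hi
    obtain ⟨j, -, rfl⟩ := Finset.mem_image.1 hi
    refine Finset.mem_filter.2 ⟨Finset.mem_univ _, ?_⟩
    have := List.get_mem (I.filter fun e => decide (e.colour = c)) j
    rw [he, List.mem_filter, decide_eq_true_eq] at this
    exact this.2
  have hcard : (Finset.univ.filter fun i => (I.get i).colour = c).card =
      (I.filter fun e => decide (e.colour = c)).length := by
    have h1 : ∀ l : List (Item m), (l.filter fun e => decide (e.colour = c)).length =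
        (l.map fun e => if e.colour = c then 1 else 0).sum := by
      intro l
      induction l with
      | nil => rfl
      | cons a l ih => by_cases h : a.colour = c <;> simp [h, ih, add_comm]
    rw [h1, Finset.card_filter]
    conv_rhs => rw [← List.ofFn_get I, List.map_ofFn, List.sum_ofFn]
    rfl
  have himg : Finset.univ.image e = Finset.univ.filter fun i => (I.get i).colour = c := by
    refine Finset.eq_of_subset_of_card_le hsub ?_
    rw [Finset.card_image_of_injective _ e.injective, hcard, Finset.card_univ, Fintype.card_fin]
  refine ⟨e, e.injective, he, fun i => ?_⟩
  have h1 := Finset.ext_iff.1 himg i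
  rw [Finset.mem_image, Finset.mem_filter] at h1
  exact ⟨fun h => (h1.2 ⟨Finset.mem_univ _, h⟩).imp fun j hj => hj.2,
    fun ⟨j, hj⟩ => (h1.1 ⟨j, Finset.mem_univ _, hj⟩).2⟩

theorem exists_bins_eq_opt {m : ℕ} (I : Instance m) : ∃ P : Packing I, P.bins = opt I := by
  refine Nat.sInf_mem (s := {k | ∃ P : Packing I, P.bins = k}) ?_
  refine ⟨_, ⟨fun i => i, fun b => ?_⟩, rfl⟩
  refine (Finset.sum_le_card_nsmul _ _ 1 fun i _ => (I.get i).size_le_one).trans ?_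
  rw [nsmul_one]
  have : (Finset.univ.filter fun i : Fin I.length => (i : ℕ) = b).card ≤ 1 :=
    Finset.card_le_one.2 fun i hi j hj =>
      Fin.ext ((Finset.mem_filter.1 hi).2.trans (Finset.mem_filter.1 hj).2.symm)
  exact_mod_cast this

theorem opt_le_span {m : ℕ} {I : Instance m} (P : Packing I) (c : Fin m) :
    opt (I.ofColour c) ≤ P.span c := by
  obtain ⟨e, h1, h2, h3⟩ := exists_embedding_ofColour I c
  have hfit : ∀ b, ∑ j with P.bin (e j) = b, ((I.ofColour c).get j).size ≤ 1 := fun b => by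
    refine le_trans ?_ (P.fits b)
    rw [Finset.sum_congr rfl fun j _ => congrArg Item.size (h2 j),
      ← Finset.sum_image (f := fun i => (I.get i).size) h1.injOn]
    refine Finset.sum_le_sum_of_subset_of_nonneg (fun i hi => ?_)
      fun i _ _ => (I.get i).size_pos.le
    obtain ⟨j, hj, rfl⟩ := Finset.mem_image.1 hi
    exact Finset.mem_filter.2 ⟨Finset.mem_univ _, (Finset.mem_filter.1 hj).2⟩
  refine le_trans (Nat.sInf_le (s := {k | ∃ P : Packing (I.ofColour c), P.bins = k})
    ⟨⟨fun j => P.bin (e j), hfit⟩, rfl⟩) (Finset.card_le_card fun b hb => ?_)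
  obtain ⟨j, -, rfl⟩ := Finset.mem_image.1 hb
  exact Finset.mem_image.2 ⟨e j, Finset.mem_filter.2 ⟨Finset.mem_univ _, (h3 _).2 ⟨j, rfl⟩⟩, rfl⟩

/-- Optimal packings of all colours, in separate bins. -/
theorem exists_span_le_opt {m : ℕ} (I : Instance m) :
    ∃ P : Packing I, ∀ c, P.span c ≤ opt (I.ofColour c) := by
  classical
  choose e h1 h2 h3 using exists_embedding_ofColour I
  choose Q hQ using fun c => exists_bins_eq_opt (I.ofColour c)
  choose j hj using fun i => (h3 (I.get i).colour i).1 rfl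
  refine ⟨⟨fun i => Nat.pair (I.get i).colour ((Q _).bin (j i)), fun b => ?_⟩, fun c => ?_⟩
  · rcases Finset.eq_empty_or_nonempty (Finset.univ.filter fun i =>
      Nat.pair (I.get i).colour ((Q _).bin (j i)) = b) with h0 | ⟨i₀, hi₀⟩
    · rw [h0]; simp
    obtain ⟨-, rfl⟩ := Finset.mem_filter.1 hi₀
    refine le_trans ?_ ((Q (I.get i₀).colour).fits ((Q _).bin (j i₀)))
    rw [Finset.sum_congr rfl fun k _ => congrArg Item.size (h2 _ k),
      ← Finset.sum_image (f := fun i => (I.get i).size) (h1 (I.get i₀).colour).injOn]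
    refine Finset.sum_le_sum_of_subset_of_nonneg (fun i hi => ?_)
      fun i _ _ => (I.get i).size_pos.le
    have hi := (Finset.mem_filter.1 hi).2
    rw [Nat.pair_eq_pair] at hi
    obtain ⟨hc, hb⟩ := hi
    have hc := Fin.ext hc
    have hi1 := hj i
    generalize j i = k at hb hi1
    revert k
    rw [hc]
    intro k hb hi1
    exact Finset.mem_image.2 ⟨k, Finset.mem_filter.2 ⟨Finset.mem_univ _, hb⟩, hi1⟩
  · rw [← hQ c, Packing.span, Packing.bins]
    have hsub : ((Finset.univ.filter fun i => (I.get i).colour = c).image fun i =>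
        Nat.pair (I.get i).colour ((Q _).bin (j i))) ⊆
        (Finset.univ.image (Q c).bin).image fun b => Nat.pair c b := by
      intro b hb
      obtain ⟨i, hi, rfl⟩ := Finset.mem_image.1 hb
      obtain ⟨-, rfl⟩ := Finset.mem_filter.1 hi
      exact Finset.mem_image_of_mem _ (Finset.mem_image_of_mem _ (Finset.mem_univ _))
    exact (Finset.card_le_card hsub).trans Finset.card_image_le

theorem exists_bins_eq_optStretch {m : ℕ} {β : ℝ} (hβ : 1 < β) (I : Instance m) :
    ∃ P : Packing I, P.ColourStretchLE β ∧ P.bins = optStretch β I := by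
  refine Nat.sInf_mem (s := {k | ∃ P : Packing I, P.ColourStretchLE β ∧ P.bins = k}) ?_
  obtain ⟨P, hP⟩ := exists_span_le_opt I
  refine ⟨_, P, fun c => ?_, rfl⟩
  have h1 : (P.span c : ℝ) ≤ opt (I.ofColour c) := by exact_mod_cast hP c
  have h2 : (0 : ℝ) ≤ opt (I.ofColour c) := Nat.cast_nonneg _
  nlinarith

/-! ### The choice of the best candidate -/

theorem fewestBins_mem {S : List (List (ℕ × ℕ × ℕ))} (hS : S ≠ []) :
    fewestBins S ∈ S ∧ ∀ b ∈ S, numBins (fewestBins S) ≤ numBins b := by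
  obtain ⟨a, ha, hmin⟩ := Finset.exists_min_image S.toFinset numBins
    (by rwa [List.toFinset_nonempty_iff])
  have h1 : a ∈ S.filter fun a => ∀ b ∈ S, numBins a ≤ numBins b := by
    rw [List.mem_filter, decide_eq_true_eq]
    exact ⟨List.mem_toFinset.1 ha, fun b hb => hmin b (List.mem_toFinset.2 hb)⟩
  have h2 : fewestBins S ∈ S.filter fun a => ∀ b ∈ S, numBins a ≤ numBins b := by
    rw [fewestBins]
    cases h : S.filter fun a => ∀ b ∈ S, numBins a ≤ numBins b with
    | nil => rw [h] at h1; simp at h1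
    | cons x l => simp
  rw [List.mem_filter, decide_eq_true_eq] at h2
  exact h2

/-- The candidate of a packing with separate colours serves as `Q`. -/
theorem algorithm_spec {m L N : ℕ} {β : ℝ} (hβ : 1 < β) (hL : 0 < L)
    (hN : ((L : ℝ) + 6) * β ≤ N) (I : Instance m) :
    ∃ P : Packing I, algorithm m L (m * (L ^ 2 + 2)) ((L + 1) ^ (m * (L ^ 2 + 2))) N I.raw =
        List.ofFn P.bin ∧
      L * P.bins ≤ (L + 6 * m) * optStretch β I + 3 * L * m ∧
      ∃ Q : Packing I, ∀ c, L * P.span c ≤ N * Q.span c + 3 * L ∧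
        L * Q.span c ≤ (L + 6) * opt (I.ofColour c) + 3 * L := by
  obtain ⟨s, hX, hs⟩ := exists_scaled L I
  obtain ⟨S, hS⟩ : ∃ S, candidates m L (m * (L ^ 2 + 2)) ((L + 1) ^ (m * (L ^ 2 + 2))) I.raw = S :=
    ⟨_, rfl⟩
  have hpk : ∀ a ∈ S, ∃ P : Packing I, a = P.triples s := fun a ha =>
    exists_packing_of_mem_candidates hL hX hs (hS ▸ ha)
  have hbal : ∀ a, a ∈ balanced m L N S ↔ a ∈ S ∧ ∀ b ∈ S, ∀ c < m,
      L * numSpan c a ≤ N * numSpan c b + 3 * L := fun a => by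
    simp only [balanced, List.mem_filter, decide_eq_true_eq, List.mem_range]
  obtain ⟨P₁, hP₁, hP₁'⟩ := exists_bins_eq_optStretch hβ I
  obtain ⟨Q₁, hQ₁, h1, h2⟩ := exists_candidate hL hX hs P₁
  obtain ⟨P₂, hP₂⟩ := exists_span_le_opt I
  obtain ⟨Q₂, hQ₂, h3, -⟩ := exists_candidate hL hX hs P₂
  rw [hS] at hQ₁ hQ₂
  have hQ₁b : Q₁.triples s ∈ balanced m L N S := by
    refine (hbal _).2 ⟨hQ₁, fun b hb c hc => ?_⟩
    obtain ⟨P, rfl⟩ := hpk b hb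
    rw [Packing.numSpan_triples Q₁ s ⟨c, hc⟩, Packing.numSpan_triples P s ⟨c, hc⟩]
    have h4 : ((L * Q₁.span ⟨c, hc⟩ : ℕ) : ℝ) ≤ ((L + 6) * P₁.span ⟨c, hc⟩ + 3 * L : ℕ) :=
      Nat.cast_le.2 (h1 _)
    have h5 := hP₁ ⟨c, hc⟩
    have h6 : ((opt (I.ofColour ⟨c, hc⟩) : ℕ) : ℝ) ≤ P.span ⟨c, hc⟩ :=
      Nat.cast_le.2 (opt_le_span P _)
    rw [← Nat.cast_le (α := ℝ)]
    refine h4.trans ?_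
    push_cast
    have h7 : ((L : ℝ) + 6) * P₁.span ⟨c, hc⟩ ≤ ((L : ℝ) + 6) * (β * P.span ⟨c, hc⟩) := by
      gcongr
      exact h5.trans (by gcongr)
    have h8 : ((L : ℝ) + 6) * β * P.span ⟨c, hc⟩ ≤ N * P.span ⟨c, hc⟩ := by gcongr
    linarith
  obtain ⟨h4, h5⟩ := fewestBins_mem (List.ne_nil_of_mem hQ₁b)
  obtain ⟨h6, h7⟩ := (hbal _).1 h4
  obtain ⟨P, hP⟩ := hpk _ h6
  refine ⟨P, ?_, ?_, Q₂, fun c => ⟨?_, ?_⟩⟩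
  · rw [algorithm, hS, hP, Packing.triples, List.map_ofFn]
    rfl
  · have h8 := h5 _ hQ₁b
    rw [hP, Packing.numBins_triples, Packing.numBins_triples] at h8
    rw [← hP₁']
    exact (Nat.mul_le_mul_left L h8).trans h2
  · have h8 := h7 _ hQ₂ c c.2
    rwa [hP, Packing.numSpan_triples, Packing.numSpan_triples] at h8
  · exact (h3 c).trans (Nat.add_le_add_right (Nat.mul_le_mul_left _ (hP₂ c)) _)

theorem enc_raw {m : ℕ} (I : Instance m) : Enc.enc I.raw = I.encode := by
  simp only [Enc.enc, Instance.raw, Instance.encode, List.map_map]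
  rfl

theorem enc_ofFn_bin {m : ℕ} {I : Instance m} (P : Packing I) :
    Enc.enc (List.ofFn P.bin) = P.encode := by
  simp only [Enc.enc, Packing.encode, List.map_ofFn]
  rfl

end ColouredBinPacking

theorem mainTheorem6 (m : ℕ) (β : ℝ) (hβ : 1 < β) :
    ∃ K C : ℝ, ∀ ε : ℝ, 0 < ε → ∃ A : ColouredBinPacking.Code,
      A.PacksInPolyTime m fun I P =>
        (P.bins : ℝ) ≤ (1 + K * ε) * (ColouredBinPacking.optStretch β I : ℝ) + C ∧
        ∀ c : Fin m,
          (P.span c : ℝ) ≤ β * (1 + K * ε) * (ColouredBinPacking.opt (I.ofColour c) : ℝ) + C := by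
  open ColouredBinPacking in
  refine ⟨m + 5, 9 * β + 3 + 3 * m, fun ε hε => ?_⟩
  obtain ⟨L, hL⟩ := exists_nat_ge (6 / ε + 6)
  have hε6 : 0 < 6 / ε := by positivity
  have hL6 : (6 : ℝ) ≤ L := by linarith
  have hL0 : (0 : ℝ) < L := by linarith
  -- In the following `6 / L` is the relative error of the candidates.
  have hδ0 : 0 < 6 / (L : ℝ) := by positivity
  have hδ1 : 6 / (L : ℝ) ≤ 1 := (div_le_one hL0).2 hL6
  have hδε : 6 / (L : ℝ) ≤ ε := by
    rw [div_le_iff₀ hL0, ← div_le_iff₀' hε]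
    linarith
  obtain ⟨A, q, hA⟩ := PolyTime.algorithm m L (m * (L ^ 2 + 2)) ((L + 1) ^ (m * (L ^ 2 + 2)))
    ⌈((L : ℝ) + 6) * β⌉₊
  refine ⟨A, q, fun I => ?_⟩
  obtain ⟨P, hP, h1, Q, h2⟩ := algorithm_spec hβ (by exact_mod_cast hL0) (Nat.le_ceil _) I
  obtain ⟨t, ht, ht', -⟩ := hA I.raw
  rw [hP, enc_raw, enc_ofFn_bin] at ht
  rw [len, enc_raw] at ht'
  refine ⟨P, t, ht, ht', ?_, fun c => ?_⟩
  · have h3 : ((L * P.bins : ℕ) : ℝ) ≤ ((L + 6 * m) * optStretch β I + 3 * L * m : ℕ) :=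
      Nat.cast_le.2 h1
    push_cast at h3
    have h4 : (P.bins : ℝ) ≤ (1 + m * (6 / L)) * optStretch β I + 3 * m := by
      refine le_of_mul_le_mul_left (h3.trans (le_of_eq ?_)) hL0
      field_simp
    have h5 : (1 + m * (6 / (L : ℝ))) * optStretch β I ≤ (1 + (m + 5) * ε) * optStretch β I := by
      gcongr
      linarith
    linarith
  · obtain ⟨h3, h4⟩ := h2 c
    have h3 : ((L * P.span c : ℕ) : ℝ) ≤ (⌈((L : ℝ) + 6) * β⌉₊ * Q.span c + 3 * L : ℕ) :=
      Nat.cast_le.2 h3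
    have h4 : ((L * Q.span c : ℕ) : ℝ) ≤ ((L + 6) * opt (I.ofColour c) + 3 * L : ℕ) :=
      Nat.cast_le.2 h4
    push_cast at h3 h4
    have h5 : (⌈((L : ℝ) + 6) * β⌉₊ : ℝ) ≤ L * ((1 + 2 * (6 / L)) * β) := by
      have h6 := (Nat.ceil_lt_add_one (show (0 : ℝ) ≤ ((L : ℝ) + 6) * β by positivity)).le
      have h7 : (L : ℝ) * ((1 + 2 * (6 / L)) * β) = (L + 12) * β := by field_simp; ring
      rw [h7]
      linarith
    have h6 : (Q.span c : ℝ) ≤ (1 + 6 / L) * opt (I.ofColour c) + 3 := by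
      refine le_of_mul_le_mul_left (h4.trans (le_of_eq ?_)) hL0
      field_simp
    have h7 : (P.span c : ℝ) ≤
        (1 + 2 * (6 / L)) * β * ((1 + 6 / L) * opt (I.ofColour c) + 3) + 3 := by
      refine le_of_mul_le_mul_left (h3.trans ?_) hL0
      have h8 : (⌈((L : ℝ) + 6) * β⌉₊ : ℝ) * Q.span c ≤
          L * ((1 + 2 * (6 / L)) * β) * ((1 + 6 / L) * opt (I.ofColour c) + 3) := by gcongr
      linarith
    have hm : (0 : ℝ) ≤ m := Nat.cast_nonneg m
    have ho : (0 : ℝ) ≤ opt (I.ofColour c) := Nat.cast_nonneg _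
    generalize 6 / (L : ℝ) = δ at *
    have h8 : (1 + 2 * δ) * (1 + δ) ≤ 1 + (m + 5) * ε := by
      have : 0 ≤ m * ε := by positivity
      nlinarith
    have h9 : β * ((1 + 2 * δ) * (1 + δ)) * opt (I.ofColour c) ≤
        β * (1 + (m + 5) * ε) * opt (I.ofColour c) := by gcongr
    have h10 : (1 + 2 * δ) * β ≤ 3 * β := by nlinarith
    calc (P.span c : ℝ) ≤ β * ((1 + 2 * δ) * (1 + δ)) * opt (I.ofColour c) +
          3 * ((1 + 2 * δ) * β) + 3 := by linarith
      _ ≤ _ := by linarith
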